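/- Let $n\ge 0$ and $S=\mathbb{R}[x_0,\ldots,x_n]$. A cone in $\mathbb{R}^{n+1}$ is the set of nonnegative combinations of a finite set of vectors; its dimension is that of its affine span $\mathrm{aff}$; a face of a cone $\sigma$ is $\sigma$ itself or its intersection with a supporting hyperplane through the origin. A fan is a finite collection of cones that is closed under taking faces and in which any two cones meet in a common face. Let $\Sigma\subset\mathbb{R}^{n+1}$ be an $(n+1)$-dimensional fan that is pure (every facet, i.e. inclusion-maximal cone, has dimension $n+1$) and hereditary (for every $\psi\in\Sigma$ the dual graph of the star of $\psi$ is connected; its vertices are the $(n+1)$-dimensional cones of the star, two of them being adjacent iff they meet in an $n$-dimensional cone). Let $\partial\Sigma$ be the set of faces of $\Sigma$ contained in an $n$-dimensional face that lies in only one facet, and let $\Sigma'\subset\partial\Sigma$ be a (possibly empty) subfan. Write $\Sigma_i,\Sigma'_i$ for the sets of $i$-dimensional cones. Let $\mathcal{R}[\Sigma,\Sigma']$ be the complex with $\mathcal{R}[\Sigma,\Sigma']_i=\bigoplus_{\gamma\in\Sigma_i\setminus\Sigma'_i}S$ and the cellular differential: for some choice of orientations of all cones, the coefficient of $\gamma\in\Sigma_i\setminus\Sigma'_i$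 in the image of the generator of $\psi\in\Sigma_{i+1}\setminus\Sigma'_{i+1}$ is the incidence number $\pm1$ comparing orientations if $\gamma$ is a face of $\psi$, and $0$ otherwise. Let $H_i(\mathcal{R}[\Sigma,\Sigma'])$ be its homology. Let $W\subset\mathbb{R}^{n+1}$ be a $d$-dimensional linear subspace with $W\subseteq\mathrm{aff}(\tau)$ for every $\tau\in\Sigma_n\setminus\Sigma'_n$. The graph $G_W=G_W(\Sigma,\Sigma')$ has one vertex for every face in $\Sigma_{d+1}\setminus\Sigma'_{d+1}$ and, in addition, a distinguished vertex $v_b$ iff some $\psi\in\Sigma_{d+2}\setminus\Sigma'_{d+2}$ has exactly one face in $\Sigma_{d+1}\setminus\Sigma'_{d+1}$. Two vertices given by distinct faces $\gamma,\gamma'$ are joined iff $\gamma$ and $\gamma'$ are faces, with affine spans containing $W$, of a common $\psi\in\Sigma_{d+2}\setminus\Sigma'_{d+2}$; the vertex of $\gamma$ is joined to $v_b$ iff $\gamma$ is the only face in $\Sigma_{d+1}\setminus\Sigma'_{d+1}$ of some $\psi\in\Sigma_{d+2}\setminus\Sigma'_{d+2}$. Then, for every choice of orientations: (1) If $\Sigma_d\setminus\Sigma'_d=\emptyset$,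 then $H_d(\mathcal{R}[\Sigma,\Sigma'])=0$. Moreover $H_{d+1}(\mathcal{R}[\Sigma,\Sigma'])=0$ if $v_b$ is a vertex of $G_W$ or $G_W$ has no vertices at all, and $H_{d+1}(\mathcal{R}[\Sigma,\Sigma'])\cong S$ as $S$-modules otherwise. (2) If $\Sigma_d\setminus\Sigma'_d\neq\emptyset$, then $H_d(\mathcal{R}[\Sigma,\Sigma'])=0$ if $d\le n$, and $H_{d+1}(\mathcal{R}[\Sigma,\Sigma'])=0$ if $d<n$. -/

import Mathlib

open Module

/-- The ambient space `ℝ^{n+1}`. -/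
abbrev Amb (n : ℕ) : Type := Fin (n + 1) → ℝ

/-- The polynomial ring `S = ℝ[x_0, …, x_n]`. -/
abbrev PolyS (n : ℕ) : Type := MvPolynomial (Fin (n + 1)) ℝ

/-- Convex cones in `ℝ^{n+1}` that contain the origin. -/
abbrev Cone (n : ℕ) : Type := PointedCone ℝ (Amb n)

namespace Cone

variable {n : ℕ}

/-- The affine span of a cone; since a cone contains the origin, this is its linear span. -/
def lin (γ : Cone n) : Submodule ℝ (Amb n) := Submodule.span ℝ (γ : Set (Amb n))

/-- The dimension of a cone is the dimension of its affine span. -/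
noncomputable def dim (γ : Cone n) : ℕ := finrank ℝ γ.lin

/-- `F` is a face of `σ`: either `σ` itself (take `f = 0`) or the intersection of `σ` with a
hyperplane `ker f` through the origin such that `σ` lies on one side of it. -/
def IsFace (F σ : Cone n) : Prop :=
  ∃ f : Amb n →ₗ[ℝ] ℝ, (∀ x ∈ σ, 0 ≤ f x) ∧ ∀ x, x ∈ F ↔ x ∈ σ ∧ f x = 0

theorem IsFace.lin_le {F σ : Cone n} (h : IsFace F σ) : F.lin ≤ σ.lin := by
  obtain ⟨f, -, hf⟩ := h
  exact Submodule.span_mono fun x hx => ((hf x).1 hx).1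

end Cone

/-- A polyhedral fan in `ℝ^{n+1}`: a finite collection of finitely generated convex cones, closed
under taking faces, any two of which meet in a common face. -/
structure Fan (n : ℕ) where
  cones : Finset (Cone n)
  fg : ∀ γ ∈ cones, Submodule.FG γ
  face_mem : ∀ γ ∈ cones, ∀ F : Cone n, Cone.IsFace F γ → F ∈ cones
  inf_face : ∀ γ₁ ∈ cones, ∀ γ₂ ∈ cones,
    Cone.IsFace (γ₁ ⊓ γ₂) γ₁ ∧ Cone.IsFace (γ₁ ⊓ γ₂) γ₂

namespace Fan

variable {n : ℕ}

/-- A facet is a face that is maximal under inclusion. -/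
def IsFacet (Sig : Fan n) (σ : Cone n) : Prop := Maximal (fun γ => γ ∈ Sig.cones) σ

/-- `Sig` is `(n+1)`-dimensional: some cone of `Sig` has dimension `n+1`. -/
def IsFullDim (Sig : Fan n) : Prop := ∃ σ ∈ Sig.cones, σ.dim = n + 1

/-- `Sig` is pure: every facet has dimension `n+1`. -/
def IsPure (Sig : Fan n) : Prop := ∀ σ, Sig.IsFacet σ → σ.dim = n + 1

/-- The star of a face `ψ`: all faces `γ` for which some cone of the fan contains both
`γ` and `ψ`. -/
def star (Sig : Fan n) (ψ : Cone n) : Set (Cone n) :=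
  {γ | γ ∈ Sig.cones ∧ ∃ σ ∈ Sig.cones, γ ≤ σ ∧ ψ ≤ σ}

/-- The dual graph of a collection `X` of cones: vertices are the `(n+1)`-dimensional cones of
`X`, two of them being adjacent iff their intersection is an `n`-dimensional cone of `X`. -/
def dualGraph (X : Set (Cone n)) : SimpleGraph {σ : Cone n // σ ∈ X ∧ σ.dim = n + 1} where
  Adj σ₁ σ₂ := σ₁.1 ⊓ σ₂.1 ∈ X ∧ (σ₁.1 ⊓ σ₂.1).dim = n
  symm := ⟨fun σ₁ σ₂ h => by rwa [inf_comm]⟩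
  loopless := ⟨fun σ h => by
    have h1 := h.2
    rw [inf_idem, σ.2.2] at h1
    omega⟩

/-- `Sig` is hereditary: the dual graph of the star of every face is connected. -/
def IsHereditary (Sig : Fan n) : Prop := ∀ ψ ∈ Sig.cones, (dualGraph (Sig.star ψ)).Connected

/-- The faces of the boundary `∂Sig`: all faces contained in a codimension one face that is
contained in a single facet. -/
def boundary (Sig : Fan n) : Set (Cone n) :=
  {γ | γ ∈ Sig.cones ∧ ∃ τ ∈ Sig.cones, τ.dim = n ∧ γ ≤ τ ∧ ∃! σ, Sig.IsFacet σ ∧ τ ≤ σ}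

open Classical in
/-- The set `Sig_i \ Sig'_i` of `i`-dimensional faces of `Sig` that do not lie in `Sig'`. -/
noncomputable def relFaces (Sig Sig' : Fan n) (i : ℕ) : Finset (Cone n) :=
  {γ ∈ Sig.cones | γ.dim = i ∧ γ ∉ Sig'.cones}

end Fan

/-- A choice of orientation of every cone, given by an ordered basis of its linear span. -/
abbrev Frames (n : ℕ) : Type := ∀ γ : Cone n, Basis (Fin γ.dim) ℝ γ.lin

open Classical in
/-- The cellular incidence number of `γ` in `ψ`. It is `0` unless `γ` is a codimension one face
of `ψ`. Otherwise it is `1` if an outward pointing vector `-v` (with `v ∈ ψ` off the span of `γ`),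
followed by the oriented basis of `γ`, is a positively oriented basis of the span of `ψ`, and `-1`
if it is negatively oriented. (This does not depend on `v`, since `ψ` lies on one side of the span
of `γ`; for `v` in the span of `γ` the determinant vanishes.) -/
noncomputable def incidence {n : ℕ} (o : Frames n) (γ ψ : Cone n) : ℤ :=
  if h : γ.IsFace ψ ∧ ψ.dim = γ.dim + 1 then
    if ∃ v : ψ.lin, (v : Amb n) ∈ ψ ∧
        0 < ((o ψ).reindex (finCongr h.2)).det
          (Fin.cons (-v) fun j => Submodule.inclusion h.1.lin_le (o γ j)) then 1
    else -1
  else 0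

namespace SplineComplex

variable {n : ℕ}

/-- The module `R[Sig, Sig']_i`, the free `S`-module on `Sig_i \ Sig'_i`. -/
abbrev Chain (Sig Sig' : Fan n) (i : ℕ) : Type := {γ // γ ∈ Sig.relFaces Sig' i} → PolyS n

/-- The cellular differential `R[Sig, Sig']_{i+1} → R[Sig, Sig']_i`. -/
noncomputable def diff (o : Frames n) (Sig Sig' : Fan n) (i : ℕ) :
    Chain Sig Sig' (i + 1) →ₗ[PolyS n] Chain Sig Sig' i :=
  Matrix.mulVecLin (Matrix.of fun γ ψ => ((incidence o γ.1 ψ.1 : ℤ) : PolyS n))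

/-- The cycles; everything is a cycle in degree `0`. -/
noncomputable def cycles (o : Frames n) (Sig Sig' : Fan n) :
    (i : ℕ) → Submodule (PolyS n) (Chain Sig Sig' i)
  | 0 => ⊤
  | i + 1 => LinearMap.ker (diff o Sig Sig' i)

/-- The homology module `H_i(R[Sig, Sig'])`: cycles modulo boundaries, where the boundaries are
regarded as a submodule of the cycles. -/
abbrev Homology (o : Frames n) (Sig Sig' : Fan n) (i : ℕ) : Type :=
  cycles o Sig Sig' i ⧸
    (LinearMap.range (diff o Sig Sig' i)).submoduleOf (cycles o Sig Sig' i)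

end SplineComplex

/-- Two distinct faces in `Sig_{d+1} \ Sig'_{d+1}` are linked when they are faces, with affine
span containing `W`, of a common `ψ ∈ Sig_{d+2} \ Sig'_{d+2}`; here `d = dim W`. -/
def Linked {n : ℕ} (Sig Sig' : Fan n) (W : Submodule ℝ (Amb n)) (γ γ' : Cone n) : Prop :=
  γ ≠ γ' ∧ γ ∈ Sig.relFaces Sig' (finrank ℝ W + 1) ∧ γ' ∈ Sig.relFaces Sig' (finrank ℝ W + 1) ∧
    ∃ ψ ∈ Sig.relFaces Sig' (finrank ℝ W + 2),
      γ.IsFace ψ ∧ γ'.IsFace ψ ∧ W ≤ γ.lin ∧ W ≤ γ'.lin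

/-- `γ` is the only face in `Sig_{d+1} \ Sig'_{d+1}` of some `ψ ∈ Sig_{d+2} \ Sig'_{d+2}`; here
`d = dim W`. -/
def LoneFace {n : ℕ} (Sig Sig' : Fan n) (W : Submodule ℝ (Amb n)) (γ : Cone n) : Prop :=
  ∃ ψ ∈ Sig.relFaces Sig' (finrank ℝ W + 2),
    ∀ γ', (γ' ∈ Sig.relFaces Sig' (finrank ℝ W + 1) ∧ γ'.IsFace ψ) ↔ γ' = γ

/-- The graph `G_W(Sig, Sig')`. The vertex of a face `γ` is `some γ`; the distinguished vertex
`v_b` is `none`. -/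
def graphW {n : ℕ} (Sig Sig' : Fan n) (W : Submodule ℝ (Amb n)) :
    (⊤ : SimpleGraph (Option (Cone n))).Subgraph where
  verts := {v | match v with
    | some γ => γ ∈ Sig.relFaces Sig' (finrank ℝ W + 1)
    | none => ∃ γ, LoneFace Sig Sig' W γ}
  Adj v w := match v, w with
    | some γ, some γ' => Linked Sig Sig' W γ γ'
    | some γ, none => LoneFace Sig Sig' W γ
    | none, some γ => LoneFace Sig Sig' W γ
    | none, none => False
  adj_sub := by
    rintro (_ | γ) (_ | γ') h
    · exact h.elim
    · simp
    · simp
    · simpa using h.1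
  edge_vert := by
    rintro (_ | γ) (_ | γ') h
    · exact h.elim
    · exact ⟨_, h⟩
    · obtain ⟨ψ, -, hψ⟩ := h
      exact ((hψ γ).2 rfl).1
    · exact h.2.1
  symm := ⟨by
    rintro (_ | γ) (_ | γ') h
    · exact h
    · exact h
    · exact h
    · obtain ⟨h1, h2, h3, ψ, hψ, h4, h5, h6, h7⟩ := h
      exact ⟨h1.symm, h3, h2, ψ, hψ, h5, h4, h7, h6⟩⟩

/-! Call a cone relative if it lies in `Sig` but not in `Sig'`, and put d = dim W. Since W lies in
the span of every relative wall, it lies in the span of every relative cone (`le_lin`). Modulo W the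
relative cones of dimension d+1 and d+2 therefore have spans of dimension one and two, so a relative
(d+2)-cone has at most two relative facets (`eq_or_eq_of_three`). If the generators in degree d+1
are oriented by a fixed basis of W, the boundary of a (d+2)-cone is, up to sign, a difference of two
generators, a single generator, or zero: the complex behaves here like the chain complex of the
graph G_W relative to v_b.

The main point is that G_W is connected when relative walls have dimension greater than d
(`graphW_induction`). Inside one facet this is the simplex algorithm (`descent`): minimize a ratio
of linear functionals and leave the minimizer along an edge of G_W. Heredity then leads from facet
to facet across walls, which are never in `Sig'`.

Hence all oriented generators agree modulo boundaries. If v_b is present, one of them is a boundary,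
so all are. If not, the augmentation kills boundaries and identifies the cokernel of the
differential into degree d+1 with S, provided there is a generator. When there are no relative
d-cones, every chain in degree d+1 is a cycle, which gives (1). Otherwise there is exactly one
relative d-cone; it spans W, lies in every relative cone and excludes v_b (`not_loneFace`). The
differential into degree d is then a nonzero multiple of the augmentation, so for d < n cycles in
degree d+1 are boundaries. -/

section LinearAlgebra

variable {V : Type*} [AddCommGroup V] [Module ℝ V]

theorem Submodule.exists_sub_smul_mem [FiniteDimensional ℝ V] {A B : Submodule ℝ V} (hAB : A ≤ B)
    (hd : finrank ℝ B = finrank ℝ A + 1) {x y : V} (hx : x ∈ B) (hxA : x ∉ A) (hy : y ∈ B) :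
    ∃ c : ℝ, y - c • x ∈ A := by
  have h1 : A ⊔ ℝ ∙ x ≤ B := sup_le hAB (by simpa using hx)
  have h2 : A < A ⊔ ℝ ∙ x := by
    refine lt_of_le_of_ne le_sup_left fun h => hxA ?_
    rw [h]
    exact Submodule.mem_sup_right (Submodule.mem_span_singleton_self x)
  have h3 := Submodule.finrank_lt_finrank_of_lt h2
  have h4 : A ⊔ ℝ ∙ x = B := Submodule.eq_of_le_of_finrank_le h1 (by omega)
  rw [← h4] at hy
  obtain ⟨a, ha, b, hb, rfl⟩ := Submodule.mem_sup.1 hy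
  obtain ⟨c, rfl⟩ := Submodule.mem_span_singleton.1 hb
  exact ⟨c, by simpa using ha⟩

/-- If `A` has codimension at least two in `B`, some functional vanishes on `A` and at `x` but not
on `B`. -/
theorem Submodule.exists_functional_ne_zero [FiniteDimensional ℝ V] {A B : Submodule ℝ V}
    (hd : finrank ℝ A + 1 < finrank ℝ B) (x : V) :
    ∃ g : V →ₗ[ℝ] ℝ, (∀ a ∈ A, g a = 0) ∧ g x = 0 ∧ ∃ y ∈ B, g y ≠ 0 := by
  have h1 : ¬ B ≤ A ⊔ ℝ ∙ x := fun h => by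
    have h2 := Submodule.finrank_mono h
    have h3 := Submodule.finrank_add_le_finrank_add_finrank A (ℝ ∙ x)
    have h4 : finrank ℝ (ℝ ∙ x) ≤ 1 := by
      simpa using finrank_span_le_card (R := ℝ) ({x} : Set V)
    omega
  obtain ⟨y, hy, hyA⟩ := SetLike.not_le_iff_exists.1 h1
  obtain ⟨g, hg, hA⟩ := Submodule.exists_le_ker_of_notMem hyA
  exact ⟨g, fun a ha => hA (Submodule.mem_sup_left ha),
    hA (Submodule.mem_sup_right (Submodule.mem_span_singleton_self x)), y, hy, hg⟩

end LinearAlgebra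

/-! ### Faces of a single cone and supporting functionals. -/

namespace Cone

variable {n : ℕ}

theorem mem_lin {γ : Cone n} {x : Amb n} (hx : x ∈ γ) : x ∈ γ.lin := Submodule.subset_span hx

theorem lin_mono {γ σ : Cone n} (h : γ ≤ σ) : γ.lin ≤ σ.lin := Submodule.span_mono h

theorem eq_zero_of_mem_lin {γ : Cone n} {f : Amb n →ₗ[ℝ] ℝ} (hf : ∀ x ∈ γ, f x = 0) {x : Amb n}
    (hx : x ∈ γ.lin) : f x = 0 :=
  (Submodule.span_le.2 fun x hx => hf x hx : γ.lin ≤ LinearMap.ker f) hx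

theorem exists_mem_notMem_of_lin_not_le {γ : Cone n} {A : Submodule ℝ (Amb n)}
    (h : ¬ γ.lin ≤ A) : ∃ x ∈ γ, x ∉ A := by
  by_contra! hc
  exact h (Submodule.span_le.2 hc)

theorem IsFace.le {F σ : Cone n} (h : F.IsFace σ) : F ≤ σ := by
  obtain ⟨f, -, hf⟩ := h
  exact fun x hx => ((hf x).1 hx).1

theorem IsFace.mem_of_mem_lin {F σ : Cone n} (h : F.IsFace σ) {x : Amb n} (hx : x ∈ σ)
    (hxF : x ∈ F.lin) : x ∈ F := by
  obtain ⟨f, -, hf⟩ := h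
  exact (hf x).2 ⟨hx, eq_zero_of_mem_lin (fun y hy => ((hf y).1 hy).2) hxF⟩

theorem IsFace.le_of_lin_le {F γ σ : Cone n} (h : F.IsFace σ) (hγ : γ ≤ σ) (hl : γ.lin ≤ F.lin) :
    γ ≤ F := fun _ hx => h.mem_of_mem_lin (hγ hx) (hl (mem_lin hx))

theorem IsFace.dim_lt {F σ : Cone n} (h : F.IsFace σ) (hne : ¬ σ ≤ F) : F.dim < σ.dim := by
  refine Submodule.finrank_lt_finrank_of_lt (lt_of_le_of_ne h.lin_le fun he => hne ?_)
  exact h.le_of_lin_le le_rfl he.ge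

theorem IsFace.eq_of_dim_le {F σ : Cone n} (h : F.IsFace σ) (hd : σ.dim ≤ F.dim) : F = σ :=
  le_antisymm h.le (not_not.1 fun hne => absurd (h.dim_lt hne) (by omega))

/-- The part of a cone on which the functional `f` vanishes. -/
def zeroFace (σ : Cone n) (f : Amb n →ₗ[ℝ] ℝ) : Cone n :=
  σ ⊓ PointedCone.ofSubmodule (LinearMap.ker f)

theorem mem_zeroFace {σ : Cone n} {f : Amb n →ₗ[ℝ] ℝ} {x : Amb n} :
    x ∈ σ.zeroFace f ↔ x ∈ σ ∧ f x = 0 := by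
  simp [zeroFace]

theorem isFace_zeroFace {σ : Cone n} {f : Amb n →ₗ[ℝ] ℝ} (hf : ∀ x ∈ σ, 0 ≤ f x) :
    (σ.zeroFace f).IsFace σ := ⟨f, hf, fun _ => mem_zeroFace⟩

/-- If `g` vanishes on the face of `σ` cut out by `f`, then a multiple of `f` touches `g` from
below along a strictly larger face. -/
theorem exists_touching {σ : Cone n} (hσ : Submodule.FG σ) {f g : Amb n →ₗ[ℝ] ℝ}
    (hf : ∀ x ∈ σ, 0 ≤ f x) (hg : ∀ x ∈ σ, f x = 0 → g x = 0) (hpos : ∃ x ∈ σ, f x ≠ 0) :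
    ∃ t : ℝ, (∀ x ∈ σ, t * f x ≤ g x) ∧ ∃ x ∈ σ, 0 < f x ∧ g x = t * f x := by
  classical
  obtain ⟨S, hS⟩ := hσ
  have hSσ : ∀ v ∈ S, v ∈ σ := fun v hv => by rw [← hS]; exact Submodule.subset_span hv
  have hne : (S.filter fun v => 0 < f v).Nonempty := by
    by_contra hc
    rw [Finset.not_nonempty_iff_eq_empty, Finset.filter_eq_empty_iff] at hc
    obtain ⟨x, hx, hx0⟩ := hpos
    refine hx0 ?_
    rw [← hS] at hx
    clear hx0
    induction hx using Submodule.span_induction with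
    | mem v hv => exact le_antisymm (not_lt.1 (hc hv)) (hf v (hSσ v hv))
    | zero => simp
    | add u v _ _ h1 h2 => rw [map_add, h1, h2, add_zero]
    | smul c v _ h1 =>
      change f ((c : ℝ) • v) = 0
      rw [map_smul, h1, smul_zero]
  -- The constant is the least ratio g/f over the finitely many generators with f > 0; at the other
  -- generators both functionals vanish.
  obtain ⟨v, hv, hmin⟩ := Finset.exists_min_image _ (fun v => g v / f v) hne
  rw [Finset.mem_filter] at hv
  refine ⟨g v / f v, fun x hx => ?_, v, hSσ v hv.1, hv.2, by field_simp [hv.2.ne']⟩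
  rw [← hS] at hx
  induction hx using Submodule.span_induction with
  | mem u hu =>
    rcases (hf u (hSσ u hu)).eq_or_lt with h0 | h0
    · rw [← h0, hg u (hSσ u hu) h0.symm, mul_zero]
    · exact (le_div_iff₀ h0).1 (hmin u (Finset.mem_filter.2 ⟨hu, h0⟩))
  | zero => simp
  | add u v _ _ h1 h2 => rw [map_add, map_add, mul_add]; exact add_le_add h1 h2
  | smul c u _ h1 =>
    change _ * f ((c : ℝ) • u) ≤ g ((c : ℝ) • u)
    rw [map_smul, map_smul, smul_eq_mul, smul_eq_mul]
    nlinarith [mul_le_mul_of_nonneg_left h1 c.2]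

/-- A codimension one face `F` of `ψ` and a point `x` of `ψ` off `F` generate `ψ` modulo the span
of `F`. -/
theorem IsFace.exists_nonneg_sub_smul_mem {F ψ : Cone n} (h : F.IsFace ψ) (hd : ψ.dim = F.dim + 1)
    {x y : Amb n} (hx : x ∈ ψ) (hxF : x ∉ F.lin) (hy : y ∈ ψ) :
    ∃ c : ℝ, 0 ≤ c ∧ y - c • x ∈ F.lin := by
  obtain ⟨c, hc⟩ := Submodule.exists_sub_smul_mem h.lin_le hd (mem_lin hx) hxF (mem_lin hy)
  refine ⟨c, ?_, hc⟩
  obtain ⟨f, hf, hF⟩ := id h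
  have hf0 : ∀ z ∈ F.lin, f z = 0 := fun z hz =>
    eq_zero_of_mem_lin (fun w hw => ((hF w).1 hw).2) hz
  have h1 := hf0 _ hc
  rw [map_sub, map_smul, smul_eq_mul, sub_eq_zero] at h1
  have h2 : 0 < f x := lt_of_le_of_ne (hf x hx) fun h0 => hxF (mem_lin ((hF x).2 ⟨hx, h0.symm⟩))
  have h3 := hf y hy
  rw [h1] at h3
  exact nonneg_of_mul_nonneg_left h3 h2

end Cone

/-! ### Covers of faces in a fan, and W in the span of every relative cone. -/

namespace Fan

variable {n : ℕ} {Sig Sig' : Fan n}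

theorem mem_relFaces {i : ℕ} {γ : Cone n} :
    γ ∈ Sig.relFaces Sig' i ↔ γ ∈ Sig.cones ∧ γ.dim = i ∧ γ ∉ Sig'.cones := by
  simp [relFaces]

theorem isFace_of_le {γ ψ : Cone n} (hγ : γ ∈ Sig.cones) (hψ : ψ ∈ Sig.cones) (h : γ ≤ ψ) :
    γ.IsFace ψ := by
  have := (Sig.inf_face γ hγ ψ hψ).2
  rwa [inf_eq_left.2 h] at this

theorem notMem_of_le {γ ψ : Cone n} (hγ : γ ∈ Sig.cones)
    (hγ' : γ ∉ Sig'.cones) (hψ : ψ ∈ Sig.cones) (h : γ ≤ ψ) : ψ ∉ Sig'.cones :=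
  fun hc => hγ' (Sig'.face_mem ψ hc γ (isFace_of_le hγ hψ h))

theorem zeroFace_mem {σ : Cone n} (hσ : σ ∈ Sig.cones) {f : Amb n →ₗ[ℝ] ℝ}
    (hf : ∀ x ∈ σ, 0 ≤ f x) : σ.zeroFace f ∈ Sig.cones :=
  Sig.face_mem σ hσ _ (Cone.isFace_zeroFace hf)

/-- If a functional vanishing on the face `F` of `σ` is negative somewhere on `σ`, then it is
negative somewhere on a face of `σ` that covers `F`. -/
theorem exists_cover {F σ : Cone n} (hF : F ∈ Sig.cones) (hσ : σ ∈ Sig.cones) (hFσ : F ≤ σ)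
    {g : Amb n →ₗ[ℝ] ℝ} (hg : ∀ x ∈ F, g x = 0) (hneg : ∃ q ∈ σ, g q < 0) :
    ∃ G ∈ Sig.cones, F ≤ G ∧ G ≤ σ ∧ G.dim = F.dim + 1 ∧ ∃ x ∈ G, g x < 0 := by
  classical
  have hne : (Sig.cones.filter fun G => F ≤ G ∧ G ≤ σ ∧ ∃ x ∈ G, g x < 0).Nonempty :=
    ⟨σ, Finset.mem_filter.2 ⟨hσ, hFσ, le_rfl, hneg⟩⟩
  -- A smallest face with a negative value is the cover. Were its codimension over F at least two,
  -- minimality would make every functional vanishing on F proportional to f on G, which is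
  -- impossible.
  obtain ⟨G, hG, hmin⟩ := Finset.exists_min_image _ Cone.dim hne
  obtain ⟨hGS, hFG, hGσ, x, hx, hgx⟩ := Finset.mem_filter.1 hG
  refine ⟨G, hGS, hFG, hGσ, ?_, x, hx, hgx⟩
  have hface := isFace_of_le hF hGS hFG
  have hlt := hface.dim_lt fun h => hgx.ne (hg x (h hx))
  by_contra hdim
  obtain ⟨f, hf, hfF⟩ := id hface
  have hf0 : ∀ y ∈ F, f y = 0 := fun y hy => ((hfF y).1 hy).2
  have hfx : f x ≠ 0 := fun h0 => hgx.ne (hg x ((hfF x).2 ⟨hx, h0⟩))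
  -- a face between `F` and `G` containing a point of negative value equals `G`
  have key : ∀ (g' : Amb n →ₗ[ℝ] ℝ) (t : ℝ), (∀ y ∈ F, g' y = 0) → (∀ y ∈ G, t * f y ≤ g' y) →
      (∃ y ∈ G, g' y = t * f y ∧ g y < 0) → ∀ y ∈ G, g' y = t * f y := by
    rintro g' t hg' ht ⟨z, hz, hz1, hz2⟩ y hy
    have hpos : ∀ y ∈ G, 0 ≤ (g' - t • f) y := fun y hy => by
      simpa using ht y hy
    have hfc := Cone.isFace_zeroFace hpos
    have hmem : G.zeroFace (g' - t • f) ∈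
        Sig.cones.filter fun G => F ≤ G ∧ G ≤ σ ∧ ∃ x ∈ G, g x < 0 := by
      refine Finset.mem_filter.2 ⟨zeroFace_mem hGS hpos, fun y hy => ?_, hfc.le.trans hGσ, z,
        Cone.mem_zeroFace.2 ⟨hz, by simp [hz1]⟩, hz2⟩
      exact Cone.mem_zeroFace.2 ⟨hFG hy, by simp [hg' y hy, hf0 y hy]⟩
    have he := hfc.eq_of_dim_le (hmin _ hmem)
    rw [← he] at hy
    simpa [sub_eq_zero] using (Cone.mem_zeroFace.1 hy).2
  obtain ⟨t, ht, z, hz, hfz, hgz⟩ := Cone.exists_touching (Sig.fg G hGS) hf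
    (fun y hy h0 => hg y ((hfF y).2 ⟨hy, h0⟩)) ⟨x, hx, hfx⟩
  have hfx' : 0 < f x := lt_of_le_of_ne (hf x hx) hfx.symm
  have htneg : t < 0 := by
    by_contra h0
    have := ht x hx
    nlinarith [mul_nonneg (not_lt.1 h0) hfx'.le]
  -- From here on g = t f on G with t < 0, so g is negative at every point of G off F, and `key`
  -- applies to any touching functional.
  have hall := key g t hg ht ⟨z, hz, hgz, by rw [hgz]; exact mul_neg_of_neg_of_pos htneg hfz⟩
  obtain ⟨g₂, hg₂F, hg₂x, y, hy, hg₂y⟩ := Submodule.exists_functional_ne_zero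
    (A := F.lin) (B := G.lin) (by change F.dim + 1 < G.dim; omega) x
  have hg₂F' : ∀ y ∈ F, g₂ y = 0 := fun y hy => hg₂F y (Cone.mem_lin hy)
  obtain ⟨s, hs, w, hw, hfw, hgw⟩ := Cone.exists_touching (Sig.fg G hGS) hf
    (fun y hy h0 => hg₂F' y ((hfF y).2 ⟨hy, h0⟩)) ⟨x, hx, hfx⟩
  have hall₂ := key g₂ s hg₂F' hs
    ⟨w, hw, hgw, by rw [hall w hw]; exact mul_neg_of_neg_of_pos htneg hfw⟩
  have hs0 : s = 0 := by
    have := hall₂ x hx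
    rw [hg₂x] at this
    exact (mul_eq_zero.1 this.symm).resolve_right hfx
  refine hg₂y (Cone.eq_zero_of_mem_lin (fun u hu => ?_) hy)
  rw [hall₂ u hu, hs0, zero_mul]

theorem exists_isFacet_le {γ : Cone n} (hγ : γ ∈ Sig.cones) : ∃ σ, Sig.IsFacet σ ∧ γ ≤ σ := by
  obtain ⟨σ, h1, h2⟩ := Sig.cones.exists_le_maximal hγ
  exact ⟨σ, h2, h1⟩

/-- If `W` lies in the spans of all walls outside `Sig'`, it lies in the spans of all cones
outside `Sig'`. -/
theorem le_lin (hpure : Sig.IsPure)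
    {W : Submodule ℝ (Amb n)} (hW : ∀ τ ∈ Sig.relFaces Sig' n, W ≤ τ.lin)
    {γ : Cone n} (hγ : γ ∈ Sig.cones) (hγ' : γ ∉ Sig'.cones) : W ≤ γ.lin := by
  induction hk : n + 1 - γ.dim using Nat.strong_induction_on generalizing γ with
  | _ k ih =>
  have hle : γ.dim ≤ n + 1 := by
    simpa [Cone.dim] using Submodule.finrank_le γ.lin
  have htop : ∀ σ : Cone n, σ.dim = n + 1 → σ.lin = ⊤ := fun σ h =>
    Submodule.eq_top_of_finrank_eq (h.trans (by simp))
  rcases hle.eq_or_lt with h1 | h1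
  · rw [htop γ h1]; exact le_top
  rcases (Nat.lt_succ_iff.1 h1).eq_or_lt with h2 | h2
  · exact hW γ (mem_relFaces.2 ⟨hγ, h2, hγ'⟩)
  obtain ⟨σ, hσ, hγσ⟩ := exists_isFacet_le hγ
  have hσd := hpure σ hσ
  have hσS : σ ∈ Sig.cones := hσ.1
  obtain ⟨f, hf, hfF⟩ := isFace_of_le hγ hσS hγσ
  have hx : ∃ x ∈ σ, f x ≠ 0 := by
    by_contra! hc
    have : σ ≤ γ := fun x hx => (hfF x).2 ⟨hx, hc x hx⟩
    have := Submodule.finrank_mono (Cone.lin_mono this)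
    change σ.dim ≤ γ.dim at this
    omega
  -- The touching face strictly contains γ, so by induction its span contains W; hence g and t f
  -- agree on W.
  have step : ∀ g : Amb n →ₗ[ℝ] ℝ, (∀ y ∈ γ, g y = 0) →
      ∃ t : ℝ, (∀ y ∈ σ, t * f y ≤ g y) ∧ ∀ w ∈ W, g w = t * f w := by
    intro g hg
    obtain ⟨t, ht, z, hz, hfz, hgz⟩ := Cone.exists_touching (Sig.fg σ hσS) hf
      (fun y hy h0 => hg y ((hfF y).2 ⟨hy, h0⟩)) hx
    refine ⟨t, ht, fun w hw => ?_⟩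
    have hpos : ∀ y ∈ σ, 0 ≤ (g - t • f) y := fun y hy => by simpa using ht y hy
    have hGS := zeroFace_mem hσS hpos
    have hle : γ ≤ σ.zeroFace (g - t • f) := fun y hy =>
      Cone.mem_zeroFace.2 ⟨hγσ hy, by simp [hg y hy, ((hfF y).1 hy).2]⟩
    have hlt := (isFace_of_le hγ hGS hle).dim_lt fun h =>
      hfz.ne' ((hfF z).1 (h (Cone.mem_zeroFace.2 ⟨hz, by simp [hgz]⟩))).2
    have hWG := ih _ (by omega) hGS (notMem_of_le hγ hγ' hGS hle) rfl
    have := Cone.eq_zero_of_mem_lin (fun y hy => (Cone.mem_zeroFace.1 hy).2) (hWG hw)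
    simpa [sub_eq_zero] using this
  obtain ⟨x, hxσ, hfx⟩ := hx
  have hfx' : 0 < f x := lt_of_le_of_ne (hf x hxσ) (Ne.symm hfx)
  -- Touching from below by g and by -g gives g = t f and -g = s f on W. Either t + s = 0, and g = t
  -- f on the full-dimensional σ, or f and g both vanish on W.
  have main : ∀ g : Amb n →ₗ[ℝ] ℝ, (∀ y ∈ γ, g y = 0) →
      (∃ t : ℝ, ∀ y, g y = t * f y) ∨ ∀ w ∈ W, f w = 0 ∧ g w = 0 := by
    intro g hg
    obtain ⟨t, ht, htW⟩ := step g hg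
    obtain ⟨s, hs, hsW⟩ := step (-g) fun y hy => by simp [hg y hy]
    by_cases hts : t + s = 0
    · refine Or.inl ⟨t, fun y => ?_⟩
      have hy : y ∈ σ.lin := by rw [htop σ hσd]; trivial
      have := Cone.eq_zero_of_mem_lin (f := g - t • f) (fun u hu => ?_) hy
      · simpa [sub_eq_zero] using this
      · have h1 := ht u hu
        have h2 := hs u hu
        have h3 : s = -t := by linarith
        rw [h3, LinearMap.neg_apply] at h2
        have : g u = t * f u := by linarith
        simp [this]
    · refine Or.inr fun w hw => ?_
      have h1 := htW w hw
      have h2 := hsW w hw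
      rw [LinearMap.neg_apply] at h2
      have h3 : (t + s) * f w = 0 := by linarith
      have h4 := (mul_eq_zero.1 h3).resolve_left hts
      exact ⟨h4, by rw [h1, h4, mul_zero]⟩
  -- Codimension at least two provides a g that is not a multiple of f, which forces the second
  -- alternative.
  have hfW : ∀ w ∈ W, f w = 0 := by
    obtain ⟨g, hgγ, hgx, y, -, hgy⟩ := Submodule.exists_functional_ne_zero
      (A := γ.lin) (B := σ.lin) (by change γ.dim + 1 < σ.dim; omega) x
    rcases main g fun y hy => hgγ y (Cone.mem_lin hy) with ⟨t, ht⟩ | h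
    · have h1 := ht x
      rw [hgx] at h1
      have h2 := (mul_eq_zero.1 h1.symm).resolve_right hfx
      exact absurd (by rw [ht y, h2, zero_mul]) hgy
    · exact fun w hw => (h w hw).1
  intro w hw
  by_contra hwγ
  obtain ⟨g, hgw, hgγ⟩ := Submodule.exists_le_ker_of_notMem hwγ
  refine hgw ?_
  rcases main g fun y hy => hgγ (Cone.mem_lin hy) with ⟨t, ht⟩ | h
  · rw [ht, hfW w hw, mul_zero]
  · exact (h w hw).2

end Fan

/-! ### Connectivity of G_W by the simplex algorithm, and relative facets of (d+2)-cones. -/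

namespace Fan

variable {n : ℕ} {Sig Sig' : Fan n}

theorem dim_le (γ : Cone n) : γ.dim ≤ n + 1 := by
  simpa [Cone.dim] using Submodule.finrank_le γ.lin

theorem isFacet_of_dim {σ : Cone n} (hσ : σ ∈ Sig.cones) (hd : σ.dim = n + 1) :
    Sig.IsFacet σ := by
  refine ⟨hσ, fun ρ hρ hle => ?_⟩
  have := (isFace_of_le hσ hρ hle).eq_of_dim_le (hd ▸ dim_le ρ)
  exact this.ge

theorem inf_mem {γ₁ γ₂ : Cone n} (h₁ : γ₁ ∈ Sig.cones) (h₂ : γ₂ ∈ Sig.cones) :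
    γ₁ ⊓ γ₂ ∈ Sig.cones := Sig.face_mem γ₁ h₁ _ (Sig.inf_face γ₁ h₁ γ₂ h₂).1

/-- A wall between two facets is not a boundary face. -/
theorem inf_mem_relFaces (hsub : ∀ γ ∈ Sig'.cones, γ ∈ Sig.boundary) {σ₁ σ₂ : Cone n}
    (h₁ : σ₁ ∈ Sig.cones) (h₂ : σ₂ ∈ Sig.cones) (hd₁ : σ₁.dim = n + 1) (hd₂ : σ₂.dim = n + 1)
    (hd : (σ₁ ⊓ σ₂).dim = n) : σ₁ ⊓ σ₂ ∈ Sig.relFaces Sig' n := by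
  refine mem_relFaces.2 ⟨inf_mem h₁ h₂, hd, fun hc => ?_⟩
  obtain ⟨hS, τ, hτ, hτd, hle, σ, -, huniq⟩ := hsub _ hc
  have he := (isFace_of_le hS hτ hle).eq_of_dim_le (by omega)
  have e₁ := huniq σ₁ ⟨isFacet_of_dim h₁ hd₁, he ▸ inf_le_left⟩
  have e₂ := huniq σ₂ ⟨isFacet_of_dim h₂ hd₂, he ▸ inf_le_right⟩
  rw [e₁, e₂, inf_idem, ← e₁] at hd
  omega

variable {W : Submodule ℝ (Amb n)}

theorem exists_mem_notMem {γ : Cone n} (hd : γ.dim = finrank ℝ W + 1) : ∃ p ∈ γ, p ∉ W :=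
  Cone.exists_mem_notMem_of_lin_not_le fun hc => by
    have h1 := Submodule.finrank_mono hc
    rw [Cone.dim] at hd
    omega

/-- The descent step of the simplex algorithm: a property of `(d+1)`-dimensional faces that
propagates along the graph `G_W` and holds for the neighbours of `v_b` passes from the faces in `T`
to all faces in `σ`. -/
theorem descent (hlin : ∀ γ ∈ Sig.cones, γ ∉ Sig'.cones → W ≤ γ.lin)
    {Q : Cone n → Prop} (hlone : ∀ γ, LoneFace Sig Sig' W γ → Q γ)
    (hlink : ∀ γ γ', Linked Sig Sig' W γ γ' → Q γ' → Q γ)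
    {T σ : Cone n} (hT : T ∈ Sig.cones) (hσ : σ ∈ Sig.cones) (hTσ : T ≤ σ) (hTW : W ≤ T.lin)
    (hQ : ∀ γ ∈ Sig.relFaces Sig' (finrank ℝ W + 1), γ ≤ T → Q γ)
    {γ : Cone n} (hγ : γ ∈ Sig.relFaces Sig' (finrank ℝ W + 1)) (hγσ : γ ≤ σ) (hTγ : ¬ T ≤ γ) :
    Q γ := by
  classical
  by_contra hnQ
  have hex : ∀ γ : Cone n, ∃ p, γ ∈ Sig.relFaces Sig' (finrank ℝ W + 1) → p ∈ γ ∧ p ∉ W := by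
    intro γ
    by_cases h : γ ∈ Sig.relFaces Sig' (finrank ℝ W + 1)
    · obtain ⟨p, hp, hpW⟩ := exists_mem_notMem (mem_relFaces.1 h).2.1
      exact ⟨p, fun _ => ⟨hp, hpW⟩⟩
    · exact ⟨0, fun h' => absurd h' h⟩
  choose p hp using hex
  obtain ⟨f, hf, hfT⟩ := isFace_of_le hT hσ hTσ
  obtain ⟨f', hf', hfγ⟩ := isFace_of_le (mem_relFaces.1 hγ).1 hσ hγσ
  have hfW : ∀ w ∈ W, f w = 0 := fun w hw =>
    Cone.eq_zero_of_mem_lin (fun x hx => ((hfT x).1 hx).2) (hTW hw)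
  have hfW' : ∀ w ∈ W, f' w = 0 := fun w hw =>
    Cone.eq_zero_of_mem_lin (fun x hx => ((hfγ x).1 hx).2)
      (hlin γ (mem_relFaces.1 hγ).1 (mem_relFaces.1 hγ).2.2 hw)
  -- Among the faces violating Q, minimize f/(f + f'), where f cuts out T and f' cuts out γ. The
  -- ratio is 0 at points of T off γ, and positive at the minimizer because Q holds inside T.
  obtain ⟨γ₀, hγ₀, hmin⟩ := Finset.exists_min_image
    ((Sig.relFaces Sig' (finrank ℝ W + 1)).filter fun γ => γ ≤ σ ∧ ¬ Q γ)
    (fun γ => f (p γ) / (f + f') (p γ)) ⟨γ, Finset.mem_filter.2 ⟨hγ, hγσ, hnQ⟩⟩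
  obtain ⟨hγ₀R, hγ₀σ, hγ₀Q⟩ := Finset.mem_filter.1 hγ₀
  obtain ⟨hγ₀S, hγ₀d, hγ₀'⟩ := mem_relFaces.1 hγ₀R
  obtain ⟨hp₀, hp₀W⟩ := hp γ₀ hγ₀R
  have hWγ₀ := hlin γ₀ hγ₀S hγ₀'
  -- a functional vanishing on `W` and at `p γ₀` vanishes on `γ₀`
  have hvan : ∀ g : Amb n →ₗ[ℝ] ℝ, (∀ w ∈ W, g w = 0) → g (p γ₀) = 0 → ∀ x ∈ γ₀, g x = 0 := by
    intro g hg hg₀ x hx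
    obtain ⟨c, hc⟩ := Submodule.exists_sub_smul_mem hWγ₀ hγ₀d (Cone.mem_lin hp₀) hp₀W
      (Cone.mem_lin hx)
    have := hg _ hc
    simpa [hg₀] using this
  have hfp₀ : 0 < f (p γ₀) := by
    refine lt_of_le_of_ne (hf _ (hγ₀σ hp₀)) fun h0 => hγ₀Q (hQ γ₀ hγ₀R fun x hx => ?_)
    exact (hfT x).2 ⟨hγ₀σ hx, hvan f hfW h0.symm x hx⟩
  have hhp₀ : 0 < (f + f') (p γ₀) := by
    have := hf' _ (hγ₀σ hp₀)
    simp only [LinearMap.add_apply]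
    linarith
  set r := f (p γ₀) / (f + f') (p γ₀) with hr
  have hrpos : 0 < r := div_pos hfp₀ hhp₀
  have hgW : ∀ w ∈ W, (f - r • (f + f')) w = 0 := fun w hw => by simp [hfW w hw, hfW' w hw]
  have hg₀ := hvan (f - r • (f + f')) hgW (by
    simp only [LinearMap.sub_apply, LinearMap.smul_apply, smul_eq_mul, hr]
    rw [div_mul_cancel₀ _ hhp₀.ne', sub_self])
  -- The functional f - r(f + f') vanishes on the minimizer and is negative at points of T off γ, so
  -- some cover ψ of the minimizer descends.
  have hneg : ∃ q ∈ σ, (f - r • (f + f')) q < 0 := by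
    obtain ⟨q, hq, hqγ⟩ := SetLike.not_le_iff_exists.1 hTγ
    refine ⟨q, hTσ hq, ?_⟩
    have h1 := ((hfT q).1 hq).2
    have h2 : 0 < f' q := lt_of_le_of_ne (hf' q (hTσ hq)) fun h0 =>
      hqγ ((hfγ q).2 ⟨hTσ hq, h0.symm⟩)
    have h3 := mul_pos hrpos h2
    simp only [LinearMap.sub_apply, LinearMap.smul_apply, LinearMap.add_apply, smul_eq_mul, h1]
    linarith
  obtain ⟨ψ, hψ, hle, hψσ, hψd, x, hx, hgx⟩ := exists_cover hγ₀S hσ hγ₀σ hg₀ hneg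
  have hψ' := notMem_of_le hγ₀S hγ₀' hψ hle
  have hψR : ψ ∈ Sig.relFaces Sig' (finrank ℝ W + 2) := mem_relFaces.2 ⟨hψ, by omega, hψ'⟩
  by_cases hcase : ∃ γ₁ ∈ Sig.relFaces Sig' (finrank ℝ W + 1), γ₁ ≤ ψ ∧ γ₁ ≠ γ₀
  · obtain ⟨γ₁, hγ₁R, hγ₁ψ, hne⟩ := hcase
    obtain ⟨hγ₁S, hγ₁d, hγ₁'⟩ := mem_relFaces.1 hγ₁R
    have hWγ₁ := hlin γ₁ hγ₁S hγ₁'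
    obtain ⟨hp₁, hp₁W⟩ := hp γ₁ hγ₁R
    have hγ₁Q : ¬ Q γ₁ := fun h => hγ₀Q (hlink γ₀ γ₁ ⟨hne.symm, hγ₀R, hγ₁R, ψ, hψR,
      isFace_of_le hγ₀S hψ hle, isFace_of_le hγ₁S hψ hγ₁ψ, hWγ₀, hWγ₁⟩ h)
    have hm := hmin γ₁ (Finset.mem_filter.2 ⟨hγ₁R, hγ₁ψ.trans hψσ, hγ₁Q⟩)
    have hface := isFace_of_le hγ₀S hψ hle
    have hp₁γ₀ : p γ₁ ∉ γ₀.lin := fun hc => by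
      have h1 : γ₁ ≤ γ₀ := by
        refine hface.le_of_lin_le hγ₁ψ fun y hy => ?_
        obtain ⟨c, hc'⟩ := Submodule.exists_sub_smul_mem hWγ₁ hγ₁d (Cone.mem_lin hp₁) hp₁W hy
        have := γ₀.lin.add_mem (hWγ₀ hc') (γ₀.lin.smul_mem c hc)
        simpa using this
      exact hne ((isFace_of_le hγ₁S hγ₀S h1).eq_of_dim_le (by omega))
    have hx₀ : x ∉ γ₀.lin := fun hc => hgx.ne (Cone.eq_zero_of_mem_lin hg₀ hc)
    -- Since ψ lies on one side of its facet γ₀, the functional is negative at the point of γ₁ too.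
    -- So γ₁ has a smaller ratio, against minimality.
    obtain ⟨c, hc, hcm⟩ := hface.exists_nonneg_sub_smul_mem (by omega) hx hx₀ (hγ₁ψ hp₁)
    have hc0 : c ≠ 0 := fun h => hp₁γ₀ (by simpa [h] using hcm)
    have hgp₁ : (f - r • (f + f')) (p γ₁) < 0 := by
      have h1 := Cone.eq_zero_of_mem_lin hg₀ hcm
      rw [map_sub, map_smul, sub_eq_zero] at h1
      rw [h1]
      exact mul_neg_of_pos_of_neg (lt_of_le_of_ne hc hc0.symm) hgx
    have h1 := hf _ (hψσ (hγ₁ψ hp₁))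
    have h2 := hf' _ (hψσ (hγ₁ψ hp₁))
    simp only [LinearMap.sub_apply, LinearMap.smul_apply, smul_eq_mul] at hgp₁
    have h3 : 0 ≤ (f + f') (p γ₁) := add_nonneg h1 h2
    have h4 : 0 < (f + f') (p γ₁) := lt_of_le_of_ne h3 fun h0 => by
      rw [← h0] at hgp₁; linarith
    have h5 := (le_div_iff₀ h4).1 hm
    linarith
  · push Not at hcase
    refine hγ₀Q (hlone γ₀ ⟨ψ, hψR, fun γ' => ⟨fun h => hcase γ' h.1 h.2.le, ?_⟩⟩)
    rintro rfl
    exact ⟨hγ₀R, isFace_of_le hγ₀S hψ hle⟩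

/-- A property of `(d+1)`-dimensional faces that propagates along the graph `G_W`, and holds for
the neighbours of `v_b` and for one face, holds for all faces. -/
theorem graphW_induction (hpure : Sig.IsPure) (hher : Sig.IsHereditary)
    (hsub : ∀ γ ∈ Sig'.cones, γ ∈ Sig.boundary)
    (hlin : ∀ γ ∈ Sig.cones, γ ∉ Sig'.cones → W ≤ γ.lin)
    (hlt : ∀ τ ∈ Sig.relFaces Sig' n, finrank ℝ W < n)
    {Q : Cone n → Prop} (hlone : ∀ γ, LoneFace Sig Sig' W γ → Q γ)
    (hlink : ∀ γ γ', Linked Sig Sig' W γ γ' → Q γ' → Q γ)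
    {γ' : Cone n} (hγ' : γ' ∈ Sig.relFaces Sig' (finrank ℝ W + 1)) (hQ : Q γ')
    {γ : Cone n} (hγ : γ ∈ Sig.relFaces Sig' (finrank ℝ W + 1)) : Q γ := by
  obtain ⟨hγ'S, hγ'd, hγ''⟩ := mem_relFaces.1 hγ'
  obtain ⟨σ', hσ', hγσ'⟩ := exists_isFacet_le hγ'S
  obtain ⟨σ, hσ, hγσ⟩ := exists_isFacet_le (mem_relFaces.1 hγ).1
  have hσd := hpure σ hσ
  have hσd' := hpure σ' hσ'
  have hσS : σ ∈ Sig.cones := hσ.1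
  have hσS' : σ' ∈ Sig.cones := hσ'.1
  have hdesc := @descent n Sig Sig' W hlin Q hlone hlink
  -- In the facet containing γ' the descent runs towards T = γ'; across each later wall it runs
  -- towards T = the wall, whose faces already satisfy Q.
  have hbase : ∀ γ ∈ Sig.relFaces Sig' (finrank ℝ W + 1), γ ≤ σ' → Q γ := by
    intro γ hγ hγσ'₁
    obtain ⟨hγS, hγd, -⟩ := mem_relFaces.1 hγ
    by_cases hle : γ' ≤ γ
    · rwa [← (isFace_of_le hγ'S hγS hle).eq_of_dim_le (by omega)]
    refine hdesc hγ'S hσS' hγσ' (hlin γ' hγ'S hγ'') (fun δ hδ hδγ => ?_) hγ hγσ'₁ hle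
    obtain ⟨hδS, hδd, -⟩ := mem_relFaces.1 hδ
    rwa [(isFace_of_le hδS hγ'S hδγ).eq_of_dim_le (by omega)]
  have hψ := inf_mem hσS hσS'
  obtain ⟨w⟩ := (hher _ hψ).preconnected
    ⟨σ, ⟨hσS, σ, hσS, le_rfl, inf_le_left⟩, hσd⟩ ⟨σ', ⟨hσS', σ', hσS', le_rfl, inf_le_right⟩, hσd'⟩
  suffices h : ∀ a b, (dualGraph (Sig.star (σ ⊓ σ'))).Walk a b →
      (∀ γ ∈ Sig.relFaces Sig' (finrank ℝ W + 1), γ ≤ b.1 → Q γ) →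
      ∀ γ ∈ Sig.relFaces Sig' (finrank ℝ W + 1), γ ≤ a.1 → Q γ from h _ _ w hbase γ hγ hγσ
  intro a b w hb
  induction w with
  | nil => exact hb
  | @cons a b c hab _ ih =>
    have ih' := ih hb
    intro γ hγ hγa
    obtain ⟨hγS, hγd, -⟩ := mem_relFaces.1 hγ
    have hτ := inf_mem_relFaces hsub a.2.1.1 b.2.1.1 a.2.2 b.2.2 hab.2
    obtain ⟨hτS, hτd, hτ'⟩ := mem_relFaces.1 hτ
    have hdn := hlt _ hτ
    by_cases hle : a.1 ⊓ b.1 ≤ γ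
    · have he := (isFace_of_le hτS hγS hle).eq_of_dim_le (by omega)
      exact ih' γ hγ (he ▸ inf_le_right)
    · exact hdesc hτS a.2.1.1 inf_le_left (hlin _ hτS hτ')
        (fun δ hδ hδτ => ih' δ hδ (hδτ.trans inf_le_right)) hγ hγa hle

/-- Points off `W` of one facet of `ψ` lie off the span of any other facet. -/
theorem notMem_lin_of_ne {ψ γ γ' : Cone n} (h : γ.IsFace ψ) (h' : γ'.IsFace ψ)
    (hd : γ.dim = finrank ℝ W + 1) (hd' : γ'.dim = finrank ℝ W + 1) (hγ : W ≤ γ.lin)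
    (hγ' : W ≤ γ'.lin) (hne : γ ≠ γ') {p : Amb n} (hp : p ∈ γ') (hpW : p ∉ W) : p ∉ γ.lin := by
  intro hpγ
  have hl : γ'.lin ≤ γ.lin := fun y hy => by
    obtain ⟨c, hc⟩ := Submodule.exists_sub_smul_mem hγ' hd' (Cone.mem_lin hp) hpW hy
    have := γ.lin.add_mem (hγ hc) (γ.lin.smul_mem c hpγ)
    simpa using this
  have hl' : γ'.lin = γ.lin := Submodule.eq_of_le_of_finrank_le hl (by
    rw [Cone.dim] at hd hd'; omega)
  exact hne (le_antisymm (h'.le_of_lin_le h.le hl'.ge) (h.le_of_lin_le h'.le hl))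

/-- A `(d+2)`-dimensional cone has at most two facets whose spans contain `W`. -/
theorem eq_or_eq_of_three {ψ γ₁ γ₂ γ₃ : Cone n} (hψ : ψ.dim = finrank ℝ W + 2)
    (hd₁ : γ₁.dim = finrank ℝ W + 1) (hd₂ : γ₂.dim = finrank ℝ W + 1)
    (hd₃ : γ₃.dim = finrank ℝ W + 1) (hW₁ : W ≤ γ₁.lin) (hW₂ : W ≤ γ₂.lin) (hW₃ : W ≤ γ₃.lin)
    (h₁ : γ₁.IsFace ψ) (h₂ : γ₂.IsFace ψ) (h₃ : γ₃.IsFace ψ) (h12 : γ₁ ≠ γ₂) :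
    γ₃ = γ₁ ∨ γ₃ = γ₂ := by
  by_contra! hne
  obtain ⟨p₁, hp₁, hp₁W⟩ := exists_mem_notMem hd₁
  obtain ⟨p₂, hp₂, hp₂W⟩ := exists_mem_notMem hd₂
  obtain ⟨p₃, hp₃, hp₃W⟩ := exists_mem_notMem hd₃
  have h21 := notMem_lin_of_ne h₁ h₂ hd₁ hd₂ hW₁ hW₂ h12 hp₂ hp₂W
  have h31 := notMem_lin_of_ne h₁ h₃ hd₁ hd₃ hW₁ hW₃ hne.1.symm hp₃ hp₃W
  have h12' := notMem_lin_of_ne h₂ h₁ hd₂ hd₁ hW₂ hW₁ h12.symm hp₁ hp₁W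
  have h32 := notMem_lin_of_ne h₂ h₃ hd₂ hd₃ hW₂ hW₃ hne.2.symm hp₃ hp₃W
  have h13 := notMem_lin_of_ne h₃ h₁ hd₃ hd₁ hW₃ hW₁ hne.1 hp₁ hp₁W
  have h23 := notMem_lin_of_ne h₃ h₂ hd₃ hd₂ hW₃ hW₂ hne.2 hp₂ hp₂W
  obtain ⟨b, hb, hbm⟩ := h₁.exists_nonneg_sub_smul_mem (by omega) (h₂.le hp₂) h21 (h₃.le hp₃)
  obtain ⟨a, ha, ham⟩ := h₂.exists_nonneg_sub_smul_mem (by omega) (h₁.le hp₁) h12' (h₃.le hp₃)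
  -- Modulo W this makes p₃ = a p₁ + b p₂ with a, b > 0, whereas the functional cutting out γ₃
  -- vanishes at p₃ and is positive at p₁ and p₂.
  obtain ⟨a', ham'⟩ := Submodule.exists_sub_smul_mem hW₁ hd₁ (Cone.mem_lin hp₁) hp₁W hbm
  have haa : a' = a := by
    by_contra hc
    have h1 : p₃ - a • p₁ - (p₃ - b • p₂ - a' • p₁) - b • p₂ ∈ γ₂.lin :=
      sub_mem (sub_mem ham (hW₂ ham')) (γ₂.lin.smul_mem b (Cone.mem_lin hp₂))
    have h2 : (a' - a) • p₁ ∈ γ₂.lin := by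
      convert h1 using 1
      rw [sub_smul]; abel
    exact h12' ((γ₂.lin.smul_mem_iff (sub_ne_zero.2 hc)).1 h2)
  have hb0 : b ≠ 0 := fun h => h31 (by simpa [h] using hbm)
  have ha0 : a ≠ 0 := fun h => h32 (by simpa [h] using ham)
  obtain ⟨f, hf, hff⟩ := id h₃
  have hf0 : ∀ x ∈ γ₃.lin, f x = 0 := fun x hx =>
    Cone.eq_zero_of_mem_lin (fun y hy => ((hff y).1 hy).2) hx
  have hfp : ∀ p ∈ ψ, p ∉ γ₃.lin → 0 < f p := fun p hp hpl =>
    lt_of_le_of_ne (hf p hp) fun h0 => hpl (Cone.mem_lin ((hff p).2 ⟨hp, h0.symm⟩))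
  have h1 := hf0 _ (hW₃ ham')
  have h2 := hf0 _ (Cone.mem_lin hp₃)
  simp only [map_sub, map_smul, smul_eq_mul, h2, haa] at h1
  have h3 := mul_pos (lt_of_le_of_ne ha ha0.symm) (hfp p₁ (h₁.le hp₁) h13)
  have h4 := mul_pos (lt_of_le_of_ne hb hb0.symm) (hfp p₂ (h₂.le hp₂) h23)
  linarith

end Fan

/-! ### Alternating forms with a prepended vector. -/

section Determinant

variable {A B : Type*} [AddCommGroup A] [Module ℝ A] [AddCommGroup B] [Module ℝ B]

theorem AlternatingMap.map_cons_neg {k : ℕ} (f : A [⋀^Fin (k + 1)]→ₗ[ℝ] ℝ) (v : A)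
    (a : Fin k → A) : f (Fin.cons (-v) a : Fin (k + 1) → A) = -f (Fin.cons v a : Fin (k + 1) → A) := by
  have h := congrArg (fun g => g a) (map_neg f.curryLeft v)
  exact h

theorem AlternatingMap.map_cons_add_smul {k : ℕ} (f : A [⋀^Fin (k + 1)]→ₗ[ℝ] ℝ) {x : A} (c : ℝ)
    (u : A) {a : Fin k → A} (hx : x ∈ Submodule.span ℝ (Set.range a)) :
    f (Fin.cons (x + c • u) a : Fin (k + 1) → A) = c * f (Fin.cons u a : Fin (k + 1) → A) := by
  let L : A →ₗ[ℝ] ℝ :=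
    { toFun := fun v => f (Fin.cons v a : Fin (k + 1) → A)
      map_add' := fun v w => congrArg (fun g => g a) (map_add f.curryLeft v w)
      map_smul' := fun r v => congrArg (fun g => g a) (map_smul f.curryLeft r v) }
  have hL : Submodule.span ℝ (Set.range a) ≤ LinearMap.ker L := by
    refine Submodule.span_le.2 ?_
    rintro _ ⟨j, rfl⟩
    exact f.map_eq_zero_of_eq _ (i := 0) (j := j.succ) (by simp) (Fin.succ_ne_zero j).symm
  change L (x + c • u) = c * L u
  rw [map_add, map_smul, LinearMap.mem_ker.1 (hL hx), zero_add, smul_eq_mul]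

theorem AlternatingMap.map_cons_cons {k : ℕ} (f : A [⋀^Fin (k + 2)]→ₗ[ℝ] ℝ) (x y : A)
    (a : Fin k → A) : f (Fin.cons x (Fin.cons y a : Fin (k + 1) → A) : Fin (k + 2) → A) =
      -f (Fin.cons y (Fin.cons x a : Fin (k + 1) → A) : Fin (k + 2) → A) := by
  rw [← f.map_swap _ (i := 0) (j := 1) (by simp)]
  congr 1
  funext i
  refine Fin.cases ?_ (fun i => Fin.cases ?_ (fun i => ?_) i) i
  · simp
  · have : (Fin.succ 0 : Fin (k + 2)) = 1 := rfl
    simp [this]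
  · have h0 : i.succ.succ ≠ (0 : Fin (k + 2)) := Fin.succ_ne_zero _
    have h1 : i.succ.succ ≠ (1 : Fin (k + 2)) := fun h =>
      Fin.succ_ne_zero i (Fin.succ_injective _ h)
    simp [Equiv.swap_apply_of_ne_of_ne h0 h1]

/-- Laplace-type factorization of a determinant over a subspace of codimension one. -/
theorem Module.Basis.det_cons_comp {m k l : ℕ} (b : Basis (Fin m) ℝ A) (b' : Basis (Fin k) ℝ B)
    (i : B →ₗ[ℝ] A) (hm : m = k + 1) (hk : k = l) (hl : m = l + 1) (v : A) (a : Fin l → B) :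
    (b.reindex (finCongr hl)).det (Fin.cons v fun j => i (a j)) =
      (b.reindex (finCongr hm)).det (Fin.cons v fun j => i (b' j)) *
        (b'.reindex (finCongr hk)).det a := by
  subst hk
  -- In `a` the left side is a top-degree alternating form on B, hence its value at `b'` times the
  -- determinant of `b'`.
  have h := congrArg (fun f => f a)
    ((((b.reindex (finCongr hm)).det.curryLeft v).compLinearMap i).eq_smul_basis_det b')
  have h2 : b'.reindex (finCongr rfl) = b' := by ext; simp
  rw [h2]
  exact h

theorem Module.Basis.det_cons_ne_zero {m k : ℕ} (b : Basis (Fin m) ℝ A) (b' : Basis (Fin k) ℝ B)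
    {i : B →ₗ[ℝ] A} (hi : Function.Injective i) (hm : m = k + 1) {v : A}
    (hv : v ∉ LinearMap.range i) :
    (b.reindex (finCongr hm)).det (Fin.cons v fun j => i (b' j)) ≠ 0 := by
  have hli : LinearIndependent ℝ (Fin.cons v fun j => i (b' j) : Fin (k + 1) → A) := by
    refine linearIndependent_finCons.2 ⟨b'.linearIndependent.map' i (LinearMap.ker_eq_bot.2 hi), ?_⟩
    refine fun h => hv (Submodule.span_le.2 ?_ h)
    rintro _ ⟨j, rfl⟩
    exact ⟨b' j, rfl⟩
  have : FiniteDimensional ℝ A := b.finiteDimensional_of_finite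
  have hcard : Fintype.card (Fin (k + 1)) = finrank ℝ A := by
    rw [finrank_eq_card_basis b, hm]
  have h := ((b.reindex (finCongr hm)).is_basis_iff_det
    (v := (Fin.cons v fun j => i (b' j) : Fin (k + 1) → A))).1
    ⟨hli, hli.span_eq_top_of_card_eq_finrank' hcard⟩
  exact h.ne_zero

end Determinant

/-! ### Incidence numbers compared with orientations relative to W. -/

section Incidence

variable {n : ℕ} (o : Frames n)

/-- The incidence number may be computed with any point off the span of the face. -/
theorem incidence_eq_sign {γ ψ : Cone n} (h : γ.IsFace ψ) (hd : ψ.dim = γ.dim + 1) {v : ψ.lin}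
    (hv : (v : Amb n) ∈ ψ) (hvγ : (v : Amb n) ∉ γ.lin) :
    ((o ψ).reindex (finCongr hd)).det
      (Fin.cons (-v) fun j => Submodule.inclusion h.lin_le (o γ j)) ≠ 0 ∧
    incidence o γ ψ = (SignType.sign (((o ψ).reindex (finCongr hd)).det
      (Fin.cons (-v) fun j => Submodule.inclusion h.lin_le (o γ j))) : ℤ) := by
  set D : ψ.lin → ℝ := fun v => ((o ψ).reindex (finCongr hd)).det
      (Fin.cons (-v) fun j => Submodule.inclusion h.lin_le (o γ j)) with hD
  have hne : ∀ u : ψ.lin, (u : Amb n) ∉ γ.lin → D u ≠ 0 := fun u hu =>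
    Module.Basis.det_cons_ne_zero (o ψ) (o γ) (Submodule.inclusion_injective _) hd (by
      rintro ⟨x, hx⟩
      refine hu ?_
      have := congrArg (fun z : ψ.lin => -(z : Amb n)) hx
      simp only [Submodule.coe_inclusion, Submodule.coe_neg, neg_neg] at this
      exact this ▸ γ.lin.neg_mem x.2)
  have hlin : ∀ (c : ℝ) (x u : ψ.lin), (x : Amb n) ∈ γ.lin → D (x + c • u) = c * D u := by
    intro c x u hx
    simp only [hD]
    rw [AlternatingMap.map_cons_neg, AlternatingMap.map_cons_neg,
      AlternatingMap.map_cons_add_smul _ c u, mul_neg]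
    have h1 : (⟨x, hx⟩ : γ.lin) ∈ Submodule.span ℝ (Set.range (o γ)) := by
      rw [(o γ).span_eq]; trivial
    have h2 := Submodule.mem_map_of_mem (f := Submodule.inclusion h.lin_le) h1
    rw [Submodule.map_span, ← Set.range_comp] at h2
    exact h2
  refine ⟨hne v hvγ, ?_⟩
  -- Modulo the span of γ each u in ψ is c v with c ≥ 0, so D u = c D v and no other point can
  -- change the sign.
  have hiff : (∃ u : ψ.lin, (u : Amb n) ∈ ψ ∧ 0 < D u) ↔ 0 < D v := by
    refine ⟨?_, fun h0 => ⟨v, hv, h0⟩⟩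
    rintro ⟨u, hu, hu0⟩
    obtain ⟨c, hc, hcm⟩ := h.exists_nonneg_sub_smul_mem hd hv hvγ hu
    have h1 := hlin c (u - c • v) v hcm
    rw [sub_add_cancel] at h1
    rw [h1] at hu0
    exact pos_of_mul_pos_right hu0 hc
  unfold incidence
  rw [dif_pos ⟨h, hd⟩]
  classical
  change (if ∃ u : ψ.lin, (u : Amb n) ∈ ψ ∧ 0 < D u then (1 : ℤ) else -1) =
    (SignType.sign (D v) : ℤ)
  by_cases h0 : 0 < D v
  · rw [if_pos (hiff.2 h0), sign_pos h0]; rfl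
  · rw [if_neg (mt hiff.1 h0), sign_neg (lt_of_le_of_ne (not_lt.1 h0) (hne v hvγ))]; rfl

theorem incidence_eq_zero {γ ψ : Cone n} (h : ¬ (γ.IsFace ψ ∧ ψ.dim = γ.dim + 1)) :
    incidence o γ ψ = 0 := by
  unfold incidence
  rw [dif_neg h]

open Classical in
/-- A point of the cone `γ` off `W`, if there is one. -/
noncomputable def facePoint (W : Submodule ℝ (Amb n)) (γ : Cone n) : Amb n :=
  if h : ∃ p ∈ γ, p ∉ W then h.choose else 0

theorem facePoint_mem {W : Submodule ℝ (Amb n)} {γ : Cone n} (hd : γ.dim = finrank ℝ W + 1) :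
    facePoint W γ ∈ γ ∧ facePoint W γ ∉ W := by
  have h := Fan.exists_mem_notMem hd
  rw [facePoint, dif_pos h]
  exact h.choose_spec

open Classical in
/-- The sign comparing the orientation of `γ` with the one given by a point of `γ` off `W` followed
by a fixed basis of `W`. -/
noncomputable def refSign (W : Submodule ℝ (Amb n)) (γ : Cone n) : ℤ :=
  if h : γ.dim = finrank ℝ W + 1 ∧ W ≤ γ.lin then
    (SignType.sign (((o γ).reindex (finCongr h.1)).det (Fin.cons
      ⟨facePoint W γ, Cone.mem_lin (facePoint_mem h.1).1⟩
      fun j => Submodule.inclusion h.2 (finBasis ℝ W j))) : ℤ)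
  else 1

variable {W : Submodule ℝ (Amb n)}

theorem refSign_mul_self (γ : Cone n) : refSign o W γ * refSign o W γ = 1 := by
  unfold refSign
  split_ifs with h
  · have hne := Module.Basis.det_cons_ne_zero (o γ) (finBasis ℝ W)
      (Submodule.inclusion_injective h.2) h.1
      (v := ⟨facePoint W γ, Cone.mem_lin (facePoint_mem h.1).1⟩) (by
        rintro ⟨x, hx⟩
        refine (facePoint_mem h.1).2 ?_
        have h1 : (x : Amb n) = facePoint W γ := congrArg Subtype.val hx
        rw [← h1]
        exact x.2)
    rcases hne.lt_or_gt with h0 | h0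
    · rw [sign_neg h0]; rfl
    · rw [sign_pos h0]; rfl
  · rfl

/-- The orientation of γ enters both factors and cancels by `Module.Basis.det_cons_comp`. What
remains depends on γ only through its chosen point, so different facets of ψ can be compared. -/
theorem incidence_mul_refSign {γ ψ : Cone n} (hψ : ψ.dim = finrank ℝ W + 2)
    (hd : γ.dim = finrank ℝ W + 1) (hW : W ≤ γ.lin) (h : γ.IsFace ψ) {v : Amb n} (hv : v ∈ ψ)
    (hvγ : v ∉ γ.lin) :
    incidence o γ ψ * refSign o W γ =
      (SignType.sign (((o ψ).reindex (finCongr hψ)).det (Fin.cons (-⟨v, Cone.mem_lin hv⟩)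
        (Fin.cons ⟨facePoint W γ, Cone.mem_lin (h.le (facePoint_mem hd).1)⟩
          fun j => Submodule.inclusion (hW.trans h.lin_le) (finBasis ℝ W j)))) : ℤ) := by
  have hd' : ψ.dim = γ.dim + 1 := by omega
  rw [(incidence_eq_sign o h hd' (v := ⟨v, Cone.mem_lin hv⟩) hv hvγ).2]
  unfold refSign
  rw [dif_pos ⟨hd, hW⟩]
  have key := Module.Basis.det_cons_comp (o ψ) (o γ) (Submodule.inclusion h.lin_le) hd' hd hψ
    (-⟨v, Cone.mem_lin hv⟩) (Fin.cons ⟨facePoint W γ, Cone.mem_lin (facePoint_mem hd).1⟩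
      fun j => Submodule.inclusion hW (finBasis ℝ W j))
  rw [← SignType.coe_mul, ← sign_mul, ← key]
  congr 4
  funext j
  exact Fin.cases rfl (fun j => rfl) j

/-- The two facets of `ψ` whose spans contain `W` enter the boundary of `ψ` with opposite signs. -/
theorem incidence_mul_refSign_add {γ₁ γ₂ ψ : Cone n} (hψ : ψ.dim = finrank ℝ W + 2)
    (hd₁ : γ₁.dim = finrank ℝ W + 1) (hd₂ : γ₂.dim = finrank ℝ W + 1) (hW₁ : W ≤ γ₁.lin)
    (hW₂ : W ≤ γ₂.lin) (h₁ : γ₁.IsFace ψ) (h₂ : γ₂.IsFace ψ) (hne : γ₁ ≠ γ₂) :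
    incidence o γ₁ ψ * refSign o W γ₁ + incidence o γ₂ ψ * refSign o W γ₂ = 0 := by
  have hp₁ := facePoint_mem hd₁
  have hp₂ := facePoint_mem hd₂
  -- Each facet uses the point of the other as its inward vector; the two determinants then differ
  -- by swapping their first two entries.
  rw [incidence_mul_refSign o hψ hd₁ hW₁ h₁ (h₂.le hp₂.1)
      (Fan.notMem_lin_of_ne h₁ h₂ hd₁ hd₂ hW₁ hW₂ hne hp₂.1 hp₂.2),
    incidence_mul_refSign o hψ hd₂ hW₂ h₂ (h₁.le hp₁.1)
      (Fan.notMem_lin_of_ne h₂ h₁ hd₂ hd₁ hW₂ hW₁ hne.symm hp₁.1 hp₁.2),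
    AlternatingMap.map_cons_neg, AlternatingMap.map_cons_neg, AlternatingMap.map_cons_cons,
    neg_neg, Left.sign_neg, SignType.coe_neg, add_neg_cancel]

/-- If the span of `δ` is `W`, then the signs `refSign` are, up to a common sign, the incidence
numbers with `δ`. -/
theorem exists_incidence_eq_mul_refSign {δ : Cone n} (hd : δ.dim = finrank ℝ W) (hW : W ≤ δ.lin) :
    ∃ c : ℤ, c ≠ 0 ∧ ∀ γ : Cone n, γ.dim = finrank ℝ W + 1 → δ.IsFace γ →
      incidence o δ γ = c * refSign o W γ := by
  have hWδ : W = δ.lin := Submodule.eq_of_le_of_finrank_eq hW hd.symm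
  have hs0 : ((o δ).reindex (finCongr hd)).det
      (fun j => Submodule.inclusion hW (finBasis ℝ W j)) ≠ 0 := by
    have hu := ((o δ).reindex (finCongr hd)).isUnit_det
      ((finBasis ℝ W).map (LinearEquiv.ofEq W δ.lin hWδ))
    have := hu.ne_zero
    exact this
  set s : SignType := SignType.sign (((o δ).reindex (finCongr hd)).det
    (fun j => Submodule.inclusion hW (finBasis ℝ W j))) with hs
  have hss : s * s = 1 := by
    rcases hs0.lt_or_gt with h0 | h0
    · rw [hs, sign_neg h0]; rfl
    · rw [hs, sign_pos h0]; rfl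
  have hss' : (s : ℤ) * s = 1 := by rw [← SignType.coe_mul, hss]; rfl
  -- Here s compares the orientation of δ with the basis of W; the minus sign comes from the outward
  -- vector in `incidence`.
  refine ⟨-s, fun h0 => ?_, fun γ hγ h => ?_⟩
  · rw [neg_eq_zero] at h0
    rw [h0] at hss'
    simp at hss'
  have hd' : γ.dim = δ.dim + 1 := by omega
  have hp := facePoint_mem hγ
  rw [(incidence_eq_sign o h hd' (v := ⟨facePoint W γ, Cone.mem_lin hp.1⟩) hp.1
    (hWδ ▸ hp.2)).2, AlternatingMap.map_cons_neg, Left.sign_neg, SignType.coe_neg]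
  unfold refSign
  rw [dif_pos ⟨hγ, hW.trans h.lin_le⟩]
  have key := Module.Basis.det_cons_comp (o γ) (o δ) (Submodule.inclusion h.lin_le) hd' hd hγ
    ⟨facePoint W γ, Cone.mem_lin hp.1⟩ (fun j => Submodule.inclusion hW (finBasis ℝ W j))
  have key' := congrArg (fun x => (SignType.sign x : ℤ)) key
  simp only [sign_mul, SignType.coe_mul] at key'
  rw [← hs] at key'
  have e : (fun j => Submodule.inclusion (hW.trans h.lin_le) (finBasis ℝ W j)) =
    fun j => Submodule.inclusion h.lin_le (Submodule.inclusion hW (finBasis ℝ W j)) := rfl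
  rw [e, key']
  linear_combination (SignType.sign (((o γ).reindex (finCongr hd')).det (Fin.cons
    ⟨facePoint W γ, Cone.mem_lin hp.1⟩ fun j => Submodule.inclusion h.lin_le (o δ j))) : ℤ) * hss'

end Incidence

theorem incidence_mul_self {n : ℕ} (o : Frames n) {γ ψ : Cone n} (h : γ.IsFace ψ)
    (hd : ψ.dim = γ.dim + 1) : incidence o γ ψ * incidence o γ ψ = 1 := by
  unfold incidence
  rw [dif_pos ⟨h, hd⟩]
  split_ifs <;> rfl

/-! ### Consequences of a relative cone with span W. -/

namespace Fan

variable {n : ℕ} {Sig Sig' : Fan n} {W : Submodule ℝ (Amb n)}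

/-- A cone outside `Sig'` with span `W` is contained in every cone outside `Sig'`. -/
theorem le_of_lin_le (hpure : Sig.IsPure) (hher : Sig.IsHereditary)
    (hsub : ∀ γ ∈ Sig'.cones, γ ∈ Sig.boundary)
    (hlin : ∀ γ ∈ Sig.cones, γ ∉ Sig'.cones → W ≤ γ.lin)
    {δ : Cone n} (hδ : δ ∈ Sig.cones) (hδW : δ.lin ≤ W) {ψ : Cone n} (hψ : ψ ∈ Sig.cones)
    (hψ' : ψ ∉ Sig'.cones) : δ ≤ ψ := by
  obtain ⟨σ, hσ, hψσ⟩ := exists_isFacet_le hψ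
  obtain ⟨σ', hσ', hδσ⟩ := exists_isFacet_le hδ
  have hσS : σ ∈ Sig.cones := hσ.1
  have hσS' : σ' ∈ Sig.cones := hσ'.1
  obtain ⟨w⟩ := (hher _ (inf_mem hσS' hσS)).preconnected
    ⟨σ', ⟨hσS', σ', hσS', le_rfl, inf_le_left⟩, hpure σ' hσ'⟩
    ⟨σ, ⟨hσS, σ, hσS, le_rfl, inf_le_right⟩, hpure σ hσ⟩
  -- Each wall crossed is a face whose span contains W, hence δ; so δ passes into the wall and on to
  -- the next facet.
  suffices h : ∀ a b, (dualGraph (Sig.star (σ' ⊓ σ))).Walk a b → δ ≤ a.1 → δ ≤ b.1 from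
    (isFace_of_le hψ hσS hψσ).le_of_lin_le (h _ _ w hδσ) (hδW.trans (hlin ψ hψ hψ'))
  intro a b w ha
  induction w with
  | nil => exact ha
  | @cons a b c hab _ ih =>
    obtain ⟨hτS, -, hτ'⟩ :=
      mem_relFaces.1 (inf_mem_relFaces hsub a.2.1.1 b.2.1.1 a.2.2 b.2.2 hab.2)
    exact ih (((isFace_of_le hτS a.2.1.1 inf_le_left).le_of_lin_le ha
      (hδW.trans (hlin _ hτS hτ'))).trans inf_le_right)

/-- If there is a cone outside `Sig'` with span `W`, then `v_b` is not a vertex of `G_W`. -/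
theorem not_loneFace (hpure : Sig.IsPure) (hher : Sig.IsHereditary)
    (hsub : ∀ γ ∈ Sig'.cones, γ ∈ Sig.boundary)
    (hlin : ∀ γ ∈ Sig.cones, γ ∉ Sig'.cones → W ≤ γ.lin)
    {δ : Cone n} (hδ : δ ∈ Sig.relFaces Sig' (finrank ℝ W)) (γ : Cone n) :
    ¬ LoneFace Sig Sig' W γ := by
  rintro ⟨ψ, hψ, huniq⟩
  obtain ⟨hδS, hδd, hδ'⟩ := mem_relFaces.1 hδ
  obtain ⟨hψS, hψd, hψ'⟩ := mem_relFaces.1 hψ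
  obtain ⟨hγ, -⟩ := (huniq γ).2 rfl
  obtain ⟨hγS, hγd, hγ'⟩ := mem_relFaces.1 hγ
  have hδW : δ.lin ≤ W := (Submodule.eq_of_le_of_finrank_eq (hlin δ hδS hδ') hδd.symm).ge
  have hle := fun {ψ} => @le_of_lin_le n Sig Sig' W hpure hher hsub hlin δ hδS hδW ψ
  obtain ⟨y, hy, hyγ⟩ := Cone.exists_mem_notMem_of_lin_not_le (γ := ψ) (A := γ.lin) fun hc => by
    have : ψ.dim ≤ γ.dim := Submodule.finrank_mono hc
    omega
  obtain ⟨g, hgy, hgγ⟩ := Submodule.exists_le_ker_of_notMem hyγ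
  -- A cover G of δ inside ψ is relative because it contains δ, so uniqueness gives G = γ, where g
  -- cannot be negative.
  have main : ∀ g : Amb n →ₗ[ℝ] ℝ, (∀ x ∈ γ, g x = 0) → ¬ g y < 0 := by
    intro g hg hneg
    obtain ⟨G, hG, hδG, hGψ, hGd, x, hx, hgx⟩ := exists_cover hδS hψS (hle hψS hψ')
      (fun x hx => hg x (hle hγS hγ' hx)) ⟨y, hy, hneg⟩
    have he := (huniq G).1 ⟨mem_relFaces.2 ⟨hG, by omega, notMem_of_le hδS hδ' hG hδG⟩,
      isFace_of_le hG hψS hGψ⟩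
    exact hgx.ne (hg x (he ▸ hx))
  have hg0 : ∀ x ∈ γ, g x = 0 := fun x hx => hgγ (Cone.mem_lin hx)
  rcases lt_or_gt_of_ne hgy with h | h
  · exact main g hg0 h
  · exact main (-g) (fun x hx => by simp [hg0 x hx]) (by simpa using h)

/-- A cone outside `Sig'` that is not full-dimensional has a cover outside `Sig'`. -/
theorem exists_cover_relFaces (hpure : Sig.IsPure) {i : ℕ} (hi : i ≤ n) {δ : Cone n}
    (hδ : δ ∈ Sig.relFaces Sig' i) : ∃ γ ∈ Sig.relFaces Sig' (i + 1), δ ≤ γ := by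
  obtain ⟨hδS, hδd, hδ'⟩ := mem_relFaces.1 hδ
  obtain ⟨σ, hσ, hδσ⟩ := exists_isFacet_le hδS
  have hσd := hpure σ hσ
  obtain ⟨f, hf, hfδ⟩ := isFace_of_le hδS hσ.1 hδσ
  obtain ⟨q, hq, hqδ⟩ := SetLike.not_le_iff_exists.1 (fun hc : σ ≤ δ => by
    have : σ.dim ≤ δ.dim := Submodule.finrank_mono (Cone.lin_mono hc)
    omega)
  obtain ⟨G, hG, hδG, -, hGd, -⟩ := exists_cover (g := -f) hδS hσ.1 hδσ
    (fun x hx => by simp [((hfδ x).1 hx).2]) ⟨q, hq, by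
      have := lt_of_le_of_ne (hf q hq) fun h0 => hqδ ((hfδ q).2 ⟨hq, h0.symm⟩)
      simpa using this⟩
  exact ⟨G, mem_relFaces.2 ⟨hG, by omega, notMem_of_le hδS hδ' hG hδG⟩, hδG⟩

end Fan

/-! ### Boundaries of generators and the augmentation. -/

namespace SplineComplex

variable {n : ℕ} (o : Frames n) (Sig Sig' : Fan n) {W : Submodule ℝ (Amb n)}

theorem subsingleton_homology {o : Frames n} {Sig Sig' : Fan n} {i : ℕ}
    (h : cycles o Sig Sig' i ≤ LinearMap.range (diff o Sig Sig' i)) :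
    Subsingleton (Homology o Sig Sig' i) := by
  rw [Submodule.Quotient.subsingleton_iff, Submodule.submoduleOf,
    Submodule.comap_subtype_eq_top]
  exact h

open Classical in
/-- The generator of the chain module that belongs to the cone `γ`. -/
noncomputable def gen (i : ℕ) (γ : Cone n) : Chain Sig Sig' i :=
  fun γ' => if γ'.1 = γ then 1 else 0

theorem diff_gen_apply {i : ℕ} {ψ : Cone n} (hψ : ψ ∈ Sig.relFaces Sig' (i + 1))
    (γ : {γ // γ ∈ Sig.relFaces Sig' i}) :
    diff o Sig Sig' i (gen Sig Sig' (i + 1) ψ) γ = ((incidence o γ.1 ψ : ℤ) : PolyS n) := by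
  classical
  simp only [diff, gen, Matrix.mulVecLin_apply, Matrix.mulVec, dotProduct, Matrix.of_apply]
  rw [Finset.sum_eq_single ⟨ψ, hψ⟩]
  · simp
  · intro b _ hb
    rw [if_neg fun h => hb (Subtype.ext h), mul_zero]
  · simp

theorem sum_smul_gen {i : ℕ} (z : Chain Sig Sig' i) : z = ∑ γ, z γ • gen Sig Sig' i γ.1 := by
  classical
  funext γ
  rw [Finset.sum_apply, Finset.sum_eq_single γ]
  · simp [gen]
  · intro b _ hb
    simp [gen, Subtype.ext_iff.not.1 hb.symm]
  · simp

theorem diff_gen_of_loneFace {ψ γ : Cone n} (hψ : ψ ∈ Sig.relFaces Sig' (finrank ℝ W + 2))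
    (huniq : ∀ γ', (γ' ∈ Sig.relFaces Sig' (finrank ℝ W + 1) ∧ γ'.IsFace ψ) ↔ γ' = γ) :
    diff o Sig Sig' (finrank ℝ W + 1) (gen Sig Sig' _ ψ) =
      ((incidence o γ ψ : ℤ) : PolyS n) • gen Sig Sig' _ γ := by
  funext γ'
  rw [diff_gen_apply o Sig Sig' hψ, Pi.smul_apply, gen, smul_eq_mul]
  split_ifs with h
  · rw [h, mul_one]
  · rw [incidence_eq_zero o fun hc => h ((huniq γ').1 ⟨γ'.2, hc.1⟩), Int.cast_zero, mul_zero]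

theorem diff_gen_of_linked (hlin : ∀ γ ∈ Sig.cones, γ ∉ Sig'.cones → W ≤ γ.lin) {ψ γ₁ γ₂ : Cone n}
    (hψ : ψ ∈ Sig.relFaces Sig' (finrank ℝ W + 2))
    (h₁ : γ₁ ∈ Sig.relFaces Sig' (finrank ℝ W + 1)) (h₂ : γ₂ ∈ Sig.relFaces Sig' (finrank ℝ W + 1))
    (hf₁ : γ₁.IsFace ψ) (hf₂ : γ₂.IsFace ψ) (hne : γ₁ ≠ γ₂) :
    diff o Sig Sig' (finrank ℝ W + 1) (gen Sig Sig' _ ψ) =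
      ((incidence o γ₁ ψ : ℤ) : PolyS n) • gen Sig Sig' _ γ₁ +
        ((incidence o γ₂ ψ : ℤ) : PolyS n) • gen Sig Sig' _ γ₂ := by
  funext γ'
  rw [diff_gen_apply o Sig Sig' hψ, Pi.add_apply, Pi.smul_apply, Pi.smul_apply, gen, gen,
    smul_eq_mul, smul_eq_mul]
  by_cases e₁ : γ'.1 = γ₁
  · rw [if_pos e₁, if_neg (e₁ ▸ hne), e₁, mul_one, mul_zero, add_zero]
  by_cases e₂ : γ'.1 = γ₂
  · rw [if_neg e₁, if_pos e₂, e₂, mul_one, mul_zero, zero_add]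
  rw [if_neg e₁, if_neg e₂, incidence_eq_zero o fun hc => ?_]
  · simp
  · obtain ⟨hS, hd, h'⟩ := Fan.mem_relFaces.1 γ'.2
    obtain ⟨hS₁, hd₁, h₁'⟩ := Fan.mem_relFaces.1 h₁
    obtain ⟨hS₂, hd₂, h₂'⟩ := Fan.mem_relFaces.1 h₂
    exact (Fan.eq_or_eq_of_three (Fan.mem_relFaces.1 hψ).2.1 hd₁ hd₂ hd (hlin _ hS₁ h₁')
      (hlin _ hS₂ h₂') (hlin _ hS h') hf₁ hf₂ hc.1 hne).elim e₁ e₂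

/-- The generator belonging to `γ`, oriented compatibly with `W`. -/
noncomputable def orientedGen (W : Submodule ℝ (Amb n)) (γ : Cone n) :
    Chain Sig Sig' (finrank ℝ W + 1) :=
  ((refSign o W γ : ℤ) : PolyS n) • gen Sig Sig' _ γ

theorem gen_eq_smul_orientedGen (γ : Cone n) :
    gen Sig Sig' _ γ = ((refSign o W γ : ℤ) : PolyS n) • orientedGen o Sig Sig' W γ := by
  rw [orientedGen, smul_smul, ← Int.cast_mul, refSign_mul_self, Int.cast_one, one_smul]

theorem orientedGen_mem_range_of_loneFace {γ : Cone n} (h : LoneFace Sig Sig' W γ) :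
    orientedGen o Sig Sig' W γ ∈ LinearMap.range (diff o Sig Sig' (finrank ℝ W + 1)) := by
  obtain ⟨ψ, hψ, huniq⟩ := h
  obtain ⟨hγ, hf⟩ := (huniq γ).2 rfl
  have hd : ψ.dim = γ.dim + 1 := by
    rw [(Fan.mem_relFaces.1 hψ).2.1, (Fan.mem_relFaces.1 hγ).2.1]
  refine Submodule.smul_mem _ _ ⟨((incidence o γ ψ : ℤ) : PolyS n) • gen Sig Sig' _ ψ, ?_⟩
  rw [map_smul, diff_gen_of_loneFace o Sig Sig' hψ huniq, smul_smul, ← Int.cast_mul,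
    incidence_mul_self o hf hd, Int.cast_one, one_smul]

/-- An edge of G_W yields a relation: by `incidence_mul_refSign_add` the two terms of the boundary
of ψ have opposite signs in the oriented generators. -/
theorem orientedGen_sub_mem_range_of_linked
    (hlin : ∀ γ ∈ Sig.cones, γ ∉ Sig'.cones → W ≤ γ.lin) {γ₁ γ₂ : Cone n}
    (h : Linked Sig Sig' W γ₁ γ₂) :
    orientedGen o Sig Sig' W γ₁ - orientedGen o Sig Sig' W γ₂ ∈
      LinearMap.range (diff o Sig Sig' (finrank ℝ W + 1)) := by
  obtain ⟨hne, h₁, h₂, ψ, hψ, hf₁, hf₂, hW₁, hW₂⟩ := h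
  have hd₁ := (Fan.mem_relFaces.1 h₁).2.1
  have hd₂ := (Fan.mem_relFaces.1 h₂).2.1
  have hdψ := (Fan.mem_relFaces.1 hψ).2.1
  have hs := incidence_mul_refSign_add o hdψ hd₁ hd₂ hW₁ hW₂ hf₁ hf₂ hne
  have hi := incidence_mul_self o hf₁ (by omega)
  refine ⟨((refSign o W γ₁ * incidence o γ₁ ψ : ℤ) : PolyS n) • gen Sig Sig' _ ψ, ?_⟩
  rw [map_smul, diff_gen_of_linked o Sig Sig' hlin hψ h₁ h₂ hf₁ hf₂ hne, smul_add, smul_smul,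
    smul_smul, orientedGen, orientedGen, ← Int.cast_mul, ← Int.cast_mul, sub_eq_add_neg, ← neg_smul,
    ← Int.cast_neg]
  have e₁ : refSign o W γ₁ * incidence o γ₁ ψ * incidence o γ₁ ψ = refSign o W γ₁ := by
    rw [mul_assoc, hi, mul_one]
  have e₂ : refSign o W γ₁ * incidence o γ₁ ψ * incidence o γ₂ ψ = -refSign o W γ₂ := by
    have hr := refSign_mul_self o (W := W) γ₂
    have hi₂ := incidence_mul_self o hf₂ (by omega)
    linear_combination incidence o γ₂ ψ * hs - refSign o W γ₂ * hi₂
  rw [e₁, e₂]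

/-- The augmentation sending every generator oriented compatibly with `W` to `1`. -/
noncomputable def augmentation (W : Submodule ℝ (Amb n)) :
    Chain Sig Sig' (finrank ℝ W + 1) →ₗ[PolyS n] PolyS n :=
  ∑ γ, ((refSign o W γ.1 : ℤ) : PolyS n) • LinearMap.proj γ

theorem augmentation_apply (z : Chain Sig Sig' (finrank ℝ W + 1)) :
    augmentation o Sig Sig' W z = ∑ γ, ((refSign o W γ.1 : ℤ) : PolyS n) * z γ := by
  simp [augmentation]

theorem augmentation_gen {γ : Cone n} (hγ : γ ∈ Sig.relFaces Sig' (finrank ℝ W + 1)) :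
    augmentation o Sig Sig' W (gen Sig Sig' _ γ) = ((refSign o W γ : ℤ) : PolyS n) := by
  classical
  rw [augmentation_apply, Finset.sum_eq_single ⟨γ, hγ⟩]
  · simp [gen]
  · intro b _ hb
    rw [gen, if_neg fun h => hb (Subtype.ext h), mul_zero]
  · simp

/-- Modulo boundaries every chain is a multiple of a given generator, if all compatibly oriented
generators agree modulo boundaries. -/
theorem sub_augmentation_smul_mem_range {γ₀ : Cone n}
    (h : ∀ γ ∈ Sig.relFaces Sig' (finrank ℝ W + 1),
      orientedGen o Sig Sig' W γ - orientedGen o Sig Sig' W γ₀ ∈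
        LinearMap.range (diff o Sig Sig' (finrank ℝ W + 1)))
    (z : Chain Sig Sig' (finrank ℝ W + 1)) :
    z - augmentation o Sig Sig' W z • orientedGen o Sig Sig' W γ₀ ∈
      LinearMap.range (diff o Sig Sig' (finrank ℝ W + 1)) := by
  have e : z - augmentation o Sig Sig' W z • orientedGen o Sig Sig' W γ₀ =
      ∑ γ, (((refSign o W γ.1 : ℤ) : PolyS n) * z γ) •
        (orientedGen o Sig Sig' W γ.1 - orientedGen o Sig Sig' W γ₀) := by
    simp only [smul_sub, Finset.sum_sub_distrib, ← Finset.sum_smul]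
    rw [← augmentation_apply]
    congr 1
    conv_lhs => rw [sum_smul_gen Sig Sig' z]
    refine Finset.sum_congr rfl fun γ _ => ?_
    rw [gen_eq_smul_orientedGen o Sig Sig' (W := W), smul_smul, mul_comm]
  rw [e]
  exact Submodule.sum_mem _ fun γ _ => Submodule.smul_mem _ _ (h γ.1 γ.2)

/-- Without v_b no ψ has exactly one relative facet, so it has none or two, and two cancel. -/
theorem augmentation_comp_diff (hlin : ∀ γ ∈ Sig.cones, γ ∉ Sig'.cones → W ≤ γ.lin)
    (hlone : ∀ γ, ¬ LoneFace Sig Sig' W γ) (y : Chain Sig Sig' (finrank ℝ W + 1 + 1)) :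
    augmentation o Sig Sig' W (diff o Sig Sig' (finrank ℝ W + 1) y) = 0 := by
  rw [sum_smul_gen Sig Sig' y, map_sum, map_sum]
  refine Finset.sum_eq_zero fun ψ _ => ?_
  rw [map_smul, map_smul]
  suffices h : augmentation o Sig Sig' W (diff o Sig Sig' (finrank ℝ W + 1)
      (gen Sig Sig' _ ψ.1)) = 0 by rw [h, smul_zero]
  have hψ : ψ.1 ∈ Sig.relFaces Sig' (finrank ℝ W + 2) := ψ.2
  by_cases hex : ∃ γ ∈ Sig.relFaces Sig' (finrank ℝ W + 1), γ.IsFace ψ.1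
  · obtain ⟨γ₁, h₁, hf₁⟩ := hex
    obtain ⟨γ₂, h₂, hf₂, hne⟩ : ∃ γ₂ ∈ Sig.relFaces Sig' (finrank ℝ W + 1),
        γ₂.IsFace ψ.1 ∧ γ₁ ≠ γ₂ := by
      by_contra! hc
      refine hlone γ₁ ⟨ψ.1, hψ, fun γ' => ⟨fun h => (hc γ' h.1 h.2).symm, ?_⟩⟩
      rintro rfl
      exact ⟨h₁, hf₁⟩
    obtain ⟨hS₁, hd₁, h₁'⟩ := Fan.mem_relFaces.1 h₁
    obtain ⟨hS₂, hd₂, h₂'⟩ := Fan.mem_relFaces.1 h₂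
    rw [diff_gen_of_linked o Sig Sig' hlin hψ h₁ h₂ hf₁ hf₂ hne, map_add, map_smul, map_smul,
      augmentation_gen o Sig Sig' h₁, augmentation_gen o Sig Sig' h₂, smul_eq_mul, smul_eq_mul,
      ← Int.cast_mul, ← Int.cast_mul, ← Int.cast_add, incidence_mul_refSign_add o
        (Fan.mem_relFaces.1 hψ).2.1 hd₁ hd₂ (hlin _ hS₁ h₁') (hlin _ hS₂ h₂') hf₁ hf₂ hne,
      Int.cast_zero]
  · push Not at hex
    rw [augmentation_apply]
    refine Finset.sum_eq_zero fun γ _ => ?_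
    rw [diff_gen_apply o Sig Sig' hψ, incidence_eq_zero o fun hc => hex γ.1 γ.2 hc.1,
      Int.cast_zero, mul_zero]

end SplineComplex

/-! ### The homology in degrees d and d+1. -/

open SplineComplex

theorem proposition4p6 (n : ℕ) (Sig Sig' : Fan n)
    (hdim : Sig.IsFullDim) (hpure : Sig.IsPure) (hher : Sig.IsHereditary)
    (hsub : ∀ γ ∈ Sig'.cones, γ ∈ Sig.boundary)
    (W : Submodule ℝ (Amb n)) (d : ℕ) (hd : Module.finrank ℝ W = d)
    (hW : ∀ τ ∈ Sig.relFaces Sig' n, W ≤ τ.lin)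
    (o : Frames n) :
    (Sig.relFaces Sig' d = ∅ →
      Subsingleton (SplineComplex.Homology o Sig Sig' d) ∧
      ((none ∈ (graphW Sig Sig' W).verts ∨ (graphW Sig Sig' W).verts = ∅) →
        Subsingleton (SplineComplex.Homology o Sig Sig' (d + 1))) ∧
      (none ∉ (graphW Sig Sig' W).verts → (graphW Sig Sig' W).verts.Nonempty →
        Nonempty (SplineComplex.Homology o Sig Sig' (d + 1) ≃ₗ[PolyS n] PolyS n))) ∧
    ((Sig.relFaces Sig' d).Nonempty →
      (d ≤ n → Subsingleton (SplineComplex.Homology o Sig Sig' d)) ∧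
      (d < n → Subsingleton (SplineComplex.Homology o Sig Sig' (d + 1)))) := by
  subst hd
  have hlin : ∀ γ ∈ Sig.cones, γ ∉ Sig'.cones → W ≤ γ.lin :=
    fun γ hγ hγ' => Fan.le_lin hpure hW hγ hγ'
  have hlink := fun {γ γ'} =>
    orientedGen_sub_mem_range_of_linked o Sig Sig' hlin (γ₁ := γ) (γ₂ := γ')
  have hagree : (∀ τ ∈ Sig.relFaces Sig' n, finrank ℝ W < n) →
      (∀ γ, ¬ LoneFace Sig Sig' W γ) → ∀ γ₀ ∈ Sig.relFaces Sig' (finrank ℝ W + 1),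
      ∀ γ ∈ Sig.relFaces Sig' (finrank ℝ W + 1),
      orientedGen o Sig Sig' W γ - orientedGen o Sig Sig' W γ₀ ∈
        LinearMap.range (diff o Sig Sig' (finrank ℝ W + 1)) := by
    intro hlt hlone γ₀ hγ₀ γ hγ
    refine Fan.graphW_induction hpure hher hsub hlin hlt
      (Q := fun γ => orientedGen o Sig Sig' W γ - orientedGen o Sig Sig' W γ₀ ∈
        LinearMap.range (diff o Sig Sig' (finrank ℝ W + 1)))
      (fun γ h => absurd h (hlone γ)) (fun γ γ' h h' => ?_) hγ₀ (by simp) hγ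
    have := add_mem (hlink h) h'
    rwa [sub_add_sub_cancel] at this
  constructor
  · intro hempty
    -- If d = n, a relative wall would itself be a relative d-cone.
    have hlt : ∀ τ ∈ Sig.relFaces Sig' n, finrank ℝ W < n := by
      intro τ hτ
      have hτd := (Fan.mem_relFaces.1 hτ).2.1
      have h1 : finrank ℝ W ≤ τ.dim := Submodule.finrank_mono (hW τ hτ)
      refine lt_of_le_of_ne (h1.trans hτd.le) fun he => ?_
      rw [he] at hempty
      exact (Finset.eq_empty_iff_forall_notMem.1 hempty) τ hτ
    have hsc : Subsingleton (Chain Sig Sig' (finrank ℝ W)) := by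
      have : IsEmpty {γ // γ ∈ Sig.relFaces Sig' (finrank ℝ W)} := ⟨fun γ =>
        (Finset.eq_empty_iff_forall_notMem.1 hempty) γ.1 γ.2⟩
      infer_instance
    refine ⟨subsingleton_homology fun z _ => ⟨0, Subsingleton.elim _ _⟩, ?_, ?_⟩
    · intro h
      refine subsingleton_homology fun z _ => ?_
      rw [sum_smul_gen Sig Sig' z]
      refine Submodule.sum_mem _ fun γ _ => Submodule.smul_mem _ _ ?_
      rw [gen_eq_smul_orientedGen o Sig Sig' (W := W)]
      refine Submodule.smul_mem _ _ ?_
      rcases h with ⟨γ₀, h₀⟩ | h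
      · obtain ⟨ψ, -, huniq⟩ := id h₀
        refine Fan.graphW_induction hpure hher hsub hlin hlt
          (Q := fun γ => orientedGen o Sig Sig' W γ ∈
            LinearMap.range (diff o Sig Sig' (finrank ℝ W + 1)))
          (fun γ h => orientedGen_mem_range_of_loneFace o Sig Sig' h) (fun γ γ' h h' => ?_)
          ((huniq γ₀).2 rfl).1 (orientedGen_mem_range_of_loneFace o Sig Sig' h₀) γ.2
        have := add_mem (hlink h) h'
        rwa [sub_add_cancel] at this
      · have hγ : some γ.1 ∈ (graphW Sig Sig' W).verts := γ.2
        rw [h] at hγ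
        exact hγ.elim
    · intro hnone hne
      have hlone : ∀ γ, ¬ LoneFace Sig Sig' W γ := fun γ h => hnone ⟨γ, h⟩
      obtain ⟨γ₀, hγ₀⟩ : ∃ γ₀, γ₀ ∈ Sig.relFaces Sig' (finrank ℝ W + 1) := by
        obtain ⟨_ | γ₀, h₀⟩ := hne
        · exact absurd h₀ hnone
        · exact ⟨γ₀, h₀⟩
      have hmem := sub_augmentation_smul_mem_range o Sig Sig' (hagree hlt hlone γ₀ hγ₀)
      have hcyc : cycles o Sig Sig' (finrank ℝ W + 1) = ⊤ :=
        eq_top_iff.2 fun z _ => Subsingleton.elim _ _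
      let φ := (augmentation o Sig Sig' W).comp (cycles o Sig Sig' (finrank ℝ W + 1)).subtype
      have hker : (LinearMap.range (diff o Sig Sig' (finrank ℝ W + 1))).submoduleOf
          (cycles o Sig Sig' (finrank ℝ W + 1)) = LinearMap.ker φ := by
        ext z
        constructor
        · rintro ⟨y, hy⟩
          have := augmentation_comp_diff o Sig Sig' hlin hlone y
          rw [hy] at this
          exact this
        · intro hz
          have h1 := hmem z.1
          have h2 : augmentation o Sig Sig' W z.1 = 0 := hz
          rw [h2, zero_smul, sub_zero] at h1
          exact h1
      have hsurj : Function.Surjective φ := by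
        intro s
        refine ⟨⟨s • orientedGen o Sig Sig' W γ₀, by rw [hcyc]; trivial⟩, ?_⟩
        change augmentation o Sig Sig' W (s • orientedGen o Sig Sig' W γ₀) = s
        rw [orientedGen, map_smul, map_smul, augmentation_gen o Sig Sig' hγ₀, smul_eq_mul,
          smul_eq_mul, ← Int.cast_mul, refSign_mul_self, Int.cast_one, mul_one]
      exact ⟨(Submodule.quotEquivOfEq _ _ hker).trans (φ.quotKerEquivOfSurjective hsurj)⟩
  · rintro ⟨δ, hδ⟩
    obtain ⟨hδS, hδd, hδ'⟩ := Fan.mem_relFaces.1 hδ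
    have hWδ := hlin δ hδS hδ'
    have hδW : δ.lin ≤ W := (Submodule.eq_of_le_of_finrank_eq hWδ hδd.symm).ge
    have hle := fun {ψ} => @Fan.le_of_lin_le n Sig Sig' W hpure hher hsub hlin δ hδS hδW ψ
    have huniq : ∀ δ' ∈ Sig.relFaces Sig' (finrank ℝ W), δ = δ' := fun δ' hδ'' => by
      obtain ⟨h1, h2, h3⟩ := Fan.mem_relFaces.1 hδ''
      exact (Fan.isFace_of_le hδS h1 (hle h1 h3)).eq_of_dim_le (by omega)
    constructor
    · intro hdn
      refine subsingleton_homology fun z _ => ?_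
      obtain ⟨G, hG, hδG⟩ := Fan.exists_cover_relFaces hpure hdn hδ
      obtain ⟨hGS, hGd, -⟩ := Fan.mem_relFaces.1 hG
      -- Degree d has the single generator δ, and the incidence number with G is a unit, being its
      -- own inverse.
      refine ⟨(((incidence o δ G : ℤ) : PolyS n) * z ⟨δ, hδ⟩) • gen Sig Sig' _ G, ?_⟩
      funext δ'
      obtain rfl : ⟨δ, hδ⟩ = δ' := Subtype.ext (huniq δ'.1 δ'.2)
      rw [map_smul, Pi.smul_apply, diff_gen_apply o Sig Sig' hG, smul_eq_mul]
      have h1 := congrArg (fun k : ℤ => (k : PolyS n))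
        (incidence_mul_self o (Fan.isFace_of_le hδS hGS hδG) (by omega))
      push_cast at h1
      linear_combination z ⟨δ, hδ⟩ * h1
    · intro hdn
      refine subsingleton_homology fun z hz => ?_
      obtain ⟨γ₀, hγ₀, -⟩ := Fan.exists_cover_relFaces hpure hdn.le hδ
      have hmem := sub_augmentation_smul_mem_range o Sig Sig' (hagree (fun _ _ => hdn)
        (Fan.not_loneFace hpure hher hsub hlin hδ) γ₀ hγ₀) z
      obtain ⟨c, hc, hcε⟩ := exists_incidence_eq_mul_refSign o hδd hWδ
      have hz0 : diff o Sig Sig' (finrank ℝ W) z ⟨δ, hδ⟩ = 0 :=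
        congrFun (LinearMap.mem_ker.1 hz) ⟨δ, hδ⟩
      -- As δ is a face of every relative (d+1)-cone, the differential is c times the augmentation;
      -- S is a domain and c ≠ 0, so a cycle has augmentation 0.
      have hsum : diff o Sig Sig' (finrank ℝ W) z ⟨δ, hδ⟩ =
          (c : PolyS n) * augmentation o Sig Sig' W z := by
        rw [augmentation_apply, Finset.mul_sum]
        simp only [diff, Matrix.mulVecLin_apply, Matrix.mulVec, dotProduct, Matrix.of_apply]
        refine Finset.sum_congr rfl fun γ _ => ?_
        obtain ⟨h1, h2, h3⟩ := Fan.mem_relFaces.1 γ.2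
        rw [hcε γ.1 h2 (Fan.isFace_of_le hδS h1 (hle h1 h3)), Int.cast_mul, mul_assoc]
      rw [hsum] at hz0
      have hz1 := (mul_eq_zero.1 hz0).resolve_left (by exact_mod_cast hc)
      rwa [hz1, zero_smul, sub_zero] at hmem
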